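/- For $N$ observations with class labels $y\in\{1,\dots,J\}^N$ ($J\ge 2$) and a set $S$ of variables, let $S_B=\sum_{j=1}^J n_j(\bar x_j-\bar x)(\bar x_j-\bar x)^T$ and $S_T=\sum_{n=1}^N (x_n-\bar x)(x_n-\bar x)^T$ be the between-class and total scatter matrices of the variables in $S$ (with class sizes $n_j$, class means $\bar x_j$, overall mean $\bar x$), and let $V(S)=\operatorname{trace}(S_T^{-1}S_B)$ be Pillai's trace. Forward selection among $M$ variables adds at every step a not yet selected variable that maximizes $V$ of the enlarged set; $V^{(k)}_{\max}$ denotes Pillai's trace of the $k$ variables selected after step $k$, $V^{(0)}_{\max}=0$. Let $1\le K\le M$ and $0<\alpha<1$, and let $t_K=t_K(N)$ be the $(1-\alpha)^{1/(M-K+1)}$ quantile of the distribution $\mathrm{Beta}\left(\frac{J-1}{2},\frac{N-J}{2}\right)$. Let $A$ be the set of the variables selected in the first $|A|\le K-1$ steps (in particular $|A|=K-1$, or $A=\emptyset$), and suppose that selection then continues, step by step as above, among the variables outside $A$. Assume the null hypothesis for these: for every $N$ the $N$ observations of each variable $i\notin A$ have a normal law $N(\mu_i,\sigma_i^2)$ with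 $\sigma_i^2>0$, all these observations (over observations and over variables) are mutually independent, and they are jointly independent of the pair formed by the variables in $A$ and the labels $y$. The joint law of the variables in $A$ and of $y$ is arbitrary, except that the total scatter matrix of the variables in $A$ is almost surely invertible for all large $N$. Then $$\limsup_{N\to\infty} P\left(V^{(K)}_{\max}-V^{(K-1)}_{\max}\ge t_K\right)\le\alpha .$$ -/

import Mathlib

open MeasureTheory ProbabilityTheory Filter
open scoped NNReal ENNReal

noncomputable section

namespace PillaiForward

/-! ### Scatter matrices and Pillai's trace

The data matrix `X` has `N` rows (observations) and columns indexed by a finite type `ι`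
(variables); `y n` is the class of observation `n`, one of `J` classes. -/

section Scatter

variable {N J : ℕ} {ι : Type*} [Fintype ι] [DecidableEq ι]

/-- The mean vector of all observations. -/
def overallMean (X : Matrix (Fin N) ι ℝ) : ι → ℝ :=
  fun a => (∑ n, X n a) / (N : ℝ)

/-- The number `n_j` of observations in class `j`. -/
def classSize (y : Fin N → Fin J) (j : Fin J) : ℕ :=
  (Finset.univ.filter fun n => y n = j).card

/-- The mean vector of the observations in class `j`. -/
def classMean (y : Fin N → Fin J) (X : Matrix (Fin N) ι ℝ) (j : Fin J) : ι → ℝ :=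
  fun a => (∑ n ∈ Finset.univ.filter (fun n => y n = j), X n a) / (classSize y j : ℝ)

/-- The between-class scatter matrix `S_B`. An empty class contributes `0`. -/
def betweenScatter (y : Fin N → Fin J) (X : Matrix (Fin N) ι ℝ) : Matrix ι ι ℝ :=
  ∑ j : Fin J, (classSize y j : ℝ) •
    Matrix.vecMulVec (classMean y X j - overallMean X) (classMean y X j - overallMean X)

/-- The total scatter matrix `S_T`. -/
def totalScatter (X : Matrix (Fin N) ι ℝ) : Matrix ι ι ℝ :=
  ∑ n : Fin N, Matrix.vecMulVec (X n - overallMean X) (X n - overallMean X)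

/-- Pillai's trace `V = trace (S_T⁻¹ S_B)`. -/
def pillai (y : Fin N → Fin J) (X : Matrix (Fin N) ι ℝ) : ℝ :=
  ((totalScatter X)⁻¹ * betweenScatter y X).trace

end Scatter

section Selection

variable {N J M : ℕ}

/-- The data matrix restricted to the variables in `S`. -/
def columns (X : Matrix (Fin N) (Fin M) ℝ) (S : Finset (Fin M)) : Matrix (Fin N) S ℝ :=
  X.submatrix id Subtype.val

/-- Pillai's trace of the variable set `S`. -/
def pillaiOf (y : Fin N → Fin J) (X : Matrix (Fin N) (Fin M) ℝ) (S : Finset (Fin M)) : ℝ :=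
  pillai y (columns X S)

/-- `S k` (for `A.card ≤ k ≤ K`) is the set of the `k` variables selected after step `k` of
forward selection, when the variables in `A` were those selected in the first `A.card` steps:
at every later step a variable is added that maximizes Pillai's trace over all candidates (ties
are broken in any way). For `A = ∅` this is forward selection from its start. -/
def IsForwardSelection (y : Fin N → Fin J) (X : Matrix (Fin N) (Fin M) ℝ)
    (A : Finset (Fin M)) (K : ℕ) (S : ℕ → Finset (Fin M)) : Prop :=
  S A.card = A ∧
    ∀ k, A.card ≤ k → k < K →
      ∃ i, i ∉ S k ∧ S (k + 1) = insert i (S k) ∧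
        ∀ j, j ∉ S k → pillaiOf y X (insert j (S k)) ≤ pillaiOf y X (insert i (S k))

end Selection

/-- The `p`-quantile of a probability measure on `ℝ`: the least `x` whose distribution function
value is at least `p`. -/
def quantile (ν : Measure ℝ) (p : ℝ) : ℝ :=
  sInf {x : ℝ | p ≤ ν.real (Set.Iic x)}

/-- The threshold `t_K`: the `(1 - α)^{1/(M-K+1)}` quantile of `Beta((J-1)/2, (N-J)/2)`. -/
def threshold (α : ℝ) (J M K N : ℕ) : ℝ :=
  quantile (betaMeasure (((J : ℝ) - 1) / 2) (((N : ℝ) - (J : ℝ)) / 2))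
    ((1 - α) ^ (1 / ((M : ℝ) - (K : ℝ) + 1)))

/-- The null hypothesis for a random sample of `N` observations of `M` variables with class
labels `y`, where `A` is the set of the variables that are not candidates: the `N` observations of
each variable `i ∉ A` have law `N(μ i, v i)`, all these observations (over `n` and over `i ∉ A`)
are mutually independent, and together they are independent of the pair formed by the variables
in `A` and the labels. Nothing is assumed on the joint law of the variables in `A` and
the labels. -/
structure IsNull {Ω : Type*} [MeasurableSpace Ω] (P : Measure Ω) {N J M : ℕ}
    (X : Ω → Matrix (Fin N) (Fin M) ℝ) (y : Ω → Fin N → Fin J)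
    (A : Finset (Fin M)) (μ : Fin M → ℝ) (v : Fin M → ℝ≥0) : Prop where
  measurable_X : ∀ n i, Measurable fun ω => X ω n i
  measurable_y : ∀ n, Measurable fun ω => y ω n
  normal : ∀ n, ∀ i ∉ A, HasLaw (fun ω => X ω n i) (gaussianReal (μ i) (v i)) P
  indep : iIndepFun (fun (q : Fin N × {i : Fin M // i ∉ A}) (ω : Ω) => X ω q.1 q.2) P
  indep_selected : IndepFun
    (fun (ω : Ω) (q : Fin N × {i : Fin M // i ∉ A}) => X ω q.1 q.2)
    (fun (ω : Ω) => ((fun q : Fin N × {i : Fin M // i ∈ A} => X ω q.1 q.2), y ω)) P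

end PillaiForward

end

/-!
Why the theorem holds.

*Geometry.* Let `h_j` be the indicator vector of class `j` scaled to norm one. Up to a constant,
Pillai's trace of a set `S` of variables is `∑ j, ‖P h_j‖ ^ 2`, where `P` is the orthogonal
projection onto the span of the constant vector and of the variables in `S` (`pillaiOf_add`). One
Gram-Schmidt step (`residual_sup_span`) shows that a new variable `i` with residual `r` increases it by
`‖C r‖ ^ 2 / ‖r‖ ^ 2`, where `C r` has the coordinates `⟪h_j, r⟫` (`pillaiOf_insert_sub`, `gain`).

*Selection has no influence to first order.* Let `z i` be a standardized candidate; it is a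
standard Gaussian vector independent of all other variables and of the labels
(`IsNull.indep_otherAlgebra`). Its inner product with a vector of norm at most one that depends only
on these has second moment at most one, hence is bounded in probability. Each candidate selected
earlier changes the residual of `z i` along one such direction only, and the class components of
that direction tend to zero because its own gain does. So `‖r‖ ^ 2 / N → 1`, and `N` times the gain
of `i`, given any selected set `S ⊇ A`, is within `o_p(1)` of `τ i = ‖C r_A‖ ^ 2`, with `r_A` the
residual given `A` alone (`negligibleInProb_gain_sub`).

*Counting.* Up to this error the `K - |A|` selected candidates all have at least the `τ` of the last
one. Any fixed set `T` of `M - K + 1` candidates contains one of them, so a gain of at least `t_K`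
at step `K` forces `τ i ≥ N t_K - o(1)` for some `i ∈ T` (`IsForwardSelection.exists_mem_lt`).

*Distribution.* Given the variables in `A` and the labels, the `τ i` are independent, and each is
stochastically smaller than a chi-squared variable with `J - 1` degrees of freedom: after removal of
the constant vector the class indicators span at most `J - 1` dimensions (`IsNull.chiSqCdf_pow_le`).
On the other side `N · Beta((J - 1) / 2, (N - J) / 2)` converges in law to that chi-squared law
(`tendsto_betaMeasure_Iic`), so `N t_K` is asymptotically at least its quantile of order
`(1 - α) ^ (1 / (M - K + 1))`. Hence all `τ i`, `i ∈ T`, stay below `N t_K` with probability at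
least `1 - α - o(1)`.
-/

open scoped InnerProductSpace Topology

namespace PillaiForward

/-! ### Residuals and projections -/

section Residual

variable {E : Type*} [NormedAddCommGroup E] [InnerProductSpace ℝ E] [FiniteDimensional ℝ E]

/-- The residual of `v` after orthogonal projection onto `U`. -/
noncomputable def residual (U : Submodule ℝ E) (v : E) : E := v - U.starProjection v

/-- The vector `v` scaled to norm one; the zero vector stays zero. -/
noncomputable def unitVec (v : E) : E := ‖v‖⁻¹ • v

omit [FiniteDimensional ℝ E] in
lemma norm_unitVec_le (v : E) : ‖unitVec v‖ ≤ 1 := by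
  rw [unitVec, norm_smul, norm_inv, norm_norm]
  exact inv_mul_le_one

lemma residual_add (U : Submodule ℝ E) (v w : E) :
    residual U (v + w) = residual U v + residual U w := by
  simp only [residual, map_add]; abel

lemma residual_smul (U : Submodule ℝ E) (c : ℝ) (v : E) :
    residual U (c • v) = c • residual U v := by
  simp only [residual, map_smul, smul_sub]

lemma residual_eq_zero_iff (U : Submodule ℝ E) (v : E) : residual U v = 0 ↔ v ∈ U := by
  rw [residual, sub_eq_zero, eq_comm, Submodule.starProjection_eq_self_iff]

lemma residual_mem_orthogonal (U : Submodule ℝ E) (v : E) : residual U v ∈ Uᗮ :=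
  U.sub_starProjection_mem_orthogonal v

lemma inner_residual_of_mem {U : Submodule ℝ E} {w : E} (hw : w ∈ U) (v : E) :
    ⟪residual U v, w⟫_ℝ = 0 :=
  U.starProjection_inner_eq_zero v w hw

lemma inner_residual_comm (U : Submodule ℝ E) (v w : E) :
    ⟪residual U v, w⟫_ℝ = ⟪v, residual U w⟫_ℝ := by
  simp only [residual, inner_sub_left, inner_sub_right, U.inner_starProjection_left_eq_right]

lemma inner_residual_residual (U : Submodule ℝ E) (v w : E) :
    ⟪residual U v, residual U w⟫_ℝ = ⟪residual U v, w⟫_ℝ := by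
  conv_lhs => rw [residual.eq_1 U w, inner_sub_right,
    inner_residual_of_mem (U.starProjection_apply_mem w), sub_zero]

lemma norm_residual_le (U : Submodule ℝ E) (v : E) : ‖residual U v‖ ≤ ‖v‖ := by
  have h : ‖residual U v‖ * ‖residual U v‖ ≤ ‖residual U v‖ * ‖v‖ := by
    rw [← real_inner_self_eq_norm_mul_norm, inner_residual_residual]
    exact real_inner_le_norm _ _
  rcases (norm_nonneg (residual U v)).eq_or_lt with h0 | h0
  · rw [← h0]; exact norm_nonneg v
  · exact le_of_mul_le_mul_left h h0

/-- One Gram-Schmidt step: adding `x` to `U` removes from a residual its component along the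
residual of `x`. -/
lemma residual_sup_span (U : Submodule ℝ E) (x v : E) :
    residual (U ⊔ ℝ ∙ x) v =
      residual U v - ⟪unitVec (residual U x), v⟫_ℝ • unitVec (residual U x) := by
  set r := residual U x with hr
  have hx : x = U.starProjection x + r := by rw [hr, residual]; abel
  have hrmem : r ∈ U ⊔ ℝ ∙ x := by
    rw [hr, residual]
    exact Submodule.sub_mem _ (Submodule.mem_sup_right (Submodule.mem_span_singleton_self x))
      (Submodule.mem_sup_left (U.starProjection_apply_mem x))
  have key : (U ⊔ ℝ ∙ x).starProjection v =
      U.starProjection v + ⟪unitVec r, v⟫_ℝ • unitVec r := by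
    apply Submodule.eq_starProjection_of_mem_of_inner_eq_zero
    · refine Submodule.add_mem _ (Submodule.mem_sup_left (U.starProjection_apply_mem v)) ?_
      exact Submodule.smul_mem _ _ (Submodule.smul_mem _ _ hrmem)
    · intro w hw
      have hU : ∀ u ∈ U, ⟪v - (U.starProjection v + ⟪unitVec r, v⟫_ℝ • unitVec r), u⟫_ℝ = 0 := by
        intro u hu
        have he : ⟪unitVec r, u⟫_ℝ = 0 := by
          rw [unitVec, inner_smul_left, hr, inner_residual_of_mem hu, mul_zero]
        rw [← sub_sub, inner_sub_left, ← residual, inner_residual_of_mem hu, inner_smul_left, he]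
        simp
      have hR : ⟪v - (U.starProjection v + ⟪unitVec r, v⟫_ℝ • unitVec r), r⟫_ℝ = 0 := by
        rw [← sub_sub, inner_sub_left, ← residual, hr, inner_residual_residual U v x,
          inner_residual_comm, ← hr, inner_smul_left, unitVec, inner_smul_left, inner_smul_left,
          real_inner_self_eq_norm_sq, real_inner_comm v r]
        by_cases h0 : r = 0
        · simp [h0]
        · have : ‖r‖ ≠ 0 := norm_ne_zero_iff.2 h0
          simp only [RCLike.conj_to_real]
          field_simp
          ring
      obtain ⟨u, hu, s, hs, rfl⟩ := Submodule.mem_sup.1 hw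
      obtain ⟨c, rfl⟩ := Submodule.mem_span_singleton.1 hs
      rw [inner_add_right, hU u hu, inner_smul_right, hx, inner_add_right,
        hU _ (U.starProjection_apply_mem x), hR]
      simp
  rw [residual, key, residual]
  abel

lemma inner_unitVec_residual (U : Submodule ℝ E) (x v : E) :
    ⟪unitVec (residual U x), residual U v⟫_ℝ = ⟪unitVec (residual U x), v⟫_ℝ := by
  rw [unitVec, inner_smul_left, inner_smul_left, inner_residual_residual]

lemma norm_sq_residual_sup_span (U : Submodule ℝ E) (x v : E) :
    ‖residual (U ⊔ ℝ ∙ x) v‖ ^ 2 =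
      ‖residual U v‖ ^ 2 - ⟪unitVec (residual U x), v⟫_ℝ ^ 2 := by
  set e := unitVec (residual U x) with he
  have h1 : ⟪residual U v, e⟫_ℝ = ⟪e, v⟫_ℝ := by
    rw [real_inner_comm, he, inner_unitVec_residual]
  rw [residual_sup_span, ← he, norm_sub_sq_real, inner_smul_right, h1, norm_smul, mul_pow,
    Real.norm_eq_abs, sq_abs]
  by_cases h0 : residual U x = 0
  · have : e = 0 := by rw [he, h0, unitVec]; simp
    simp [this]
  · have : ‖e‖ = 1 := by
      rw [he, unitVec, norm_smul, norm_inv, norm_norm]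
      exact inv_mul_cancel₀ (norm_ne_zero_iff.2 h0)
    rw [this]; ring

lemma norm_sq_starProjection (U : Submodule ℝ E) (v : E) :
    ‖U.starProjection v‖ ^ 2 = ‖v‖ ^ 2 - ‖residual U v‖ ^ 2 := by
  have := U.norm_sq_eq_add_norm_sq_starProjection v
  rw [Submodule.starProjection_orthogonal_val] at this
  rw [residual]
  linarith

lemma norm_sq_starProjection_sup_span (U : Submodule ℝ E) (x v : E) :
    ‖(U ⊔ ℝ ∙ x).starProjection v‖ ^ 2 =
      ‖U.starProjection v‖ ^ 2 + ⟪unitVec (residual U x), v⟫_ℝ ^ 2 := by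
  rw [norm_sq_starProjection, norm_sq_starProjection, norm_sq_residual_sup_span]
  ring

/-- The squared norm of a projection onto the span of linearly independent vectors, through the
inverse of their Gram matrix. -/
lemma norm_sq_starProjection_span_range {ι : Type*} [Fintype ι] [DecidableEq ι] (c : ι → E)
    (hG : IsUnit (Matrix.gram ℝ c).det) (w : E) :
    ‖(Submodule.span ℝ (Set.range c)).starProjection w‖ ^ 2 =
      (fun a => ⟪c a, w⟫_ℝ) ⬝ᵥ ((Matrix.gram ℝ c)⁻¹.mulVec fun a => ⟪c a, w⟫_ℝ) := by
  set G := Matrix.gram ℝ c with hGdef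
  set b : ι → ℝ := fun a => ⟪c a, w⟫_ℝ with hb
  set k : ι → ℝ := G⁻¹.mulVec b with hk
  have hGk : G.mulVec k = b := by
    rw [hk, Matrix.mulVec_mulVec, Matrix.mul_nonsing_inv _ hG, Matrix.one_mulVec]
  have hP : (Submodule.span ℝ (Set.range c)).starProjection w = ∑ a, k a • c a := by
    apply Submodule.eq_starProjection_of_mem_of_inner_eq_zero
    · exact Submodule.sum_mem _ fun a _ =>
        Submodule.smul_mem _ _ (Submodule.subset_span ⟨a, rfl⟩)
    · intro u hu
      have hle : Submodule.span ℝ (Set.range c) ≤ (ℝ ∙ (w - ∑ a, k a • c a))ᗮ := by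
        rw [Submodule.span_le]
        rintro _ ⟨a, rfl⟩
        rw [SetLike.mem_coe, Submodule.mem_orthogonal_singleton_iff_inner_left, inner_sub_right,
          inner_sum]
        have := congrFun hGk a
        simp only [Matrix.mulVec, dotProduct, hGdef, Matrix.gram_apply, hb] at this
        simp only [inner_smul_right]
        rw [← this, sub_eq_zero]
        exact Finset.sum_congr rfl fun i _ => mul_comm _ _
      exact Submodule.mem_orthogonal_singleton_iff_inner_right.1 (hle hu)
  have h1 : ‖(Submodule.span ℝ (Set.range c)).starProjection w‖ ^ 2 =
      ⟪(Submodule.span ℝ (Set.range c)).starProjection w, w⟫_ℝ := by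
    rw [← real_inner_self_eq_norm_sq, Submodule.inner_starProjection_left_eq_right,
      (Submodule.starProjection_eq_self_iff).2 (Submodule.starProjection_apply_mem _ _),
      ← Submodule.inner_starProjection_left_eq_right]
  rw [h1, hP, sum_inner]
  simp only [dotProduct, inner_smul_left, hb]
  exact Finset.sum_congr rfl fun i _ => mul_comm _ _

end Residual

/-! ### Pillai's trace as a sum of squared projections -/

section OrthogonalSup

variable {E : Type*} [NormedAddCommGroup E] [InnerProductSpace ℝ E] [FiniteDimensional ℝ E]

lemma norm_sq_starProjection_sup_of_le_orthogonal {U V : Submodule ℝ E} (h : V ≤ Uᗮ) (v : E) :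
    ‖(U ⊔ V).starProjection v‖ ^ 2 =
      ‖U.starProjection v‖ ^ 2 + ‖V.starProjection v‖ ^ 2 := by
  have hort : ∀ u ∈ U, ∀ w ∈ V, ⟪u, w⟫_ℝ = 0 := fun u hu w hw =>
    (Submodule.mem_orthogonal U w).1 (h hw) u hu
  have key : (U ⊔ V).starProjection v = U.starProjection v + V.starProjection v := by
    apply Submodule.eq_starProjection_of_mem_of_inner_eq_zero
    · exact Submodule.add_mem _ (Submodule.mem_sup_left (U.starProjection_apply_mem v))
        (Submodule.mem_sup_right (V.starProjection_apply_mem v))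
    · intro w hw
      obtain ⟨u, hu, s, hs, rfl⟩ := Submodule.mem_sup.1 hw
      have h1 := U.starProjection_inner_eq_zero v u hu
      have h2 := V.starProjection_inner_eq_zero v s hs
      have h3 := hort _ hu _ (V.starProjection_apply_mem v)
      have h4 := hort _ (U.starProjection_apply_mem v) _ hs
      rw [inner_sub_left] at h1 h2
      rw [real_inner_comm] at h3
      simp only [inner_add_right, inner_sub_left, inner_add_left]
      linarith
  rw [key, norm_add_sq_real, hort _ (U.starProjection_apply_mem v) _ (V.starProjection_apply_mem v)]
  ring

end OrthogonalSup

variable {N J M : ℕ}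

/-- The observations of the variable `i`, as a vector of Euclidean space. -/
noncomputable def colVec (X : Matrix (Fin N) (Fin M) ℝ) (i : Fin M) : EuclideanSpace ℝ (Fin N) :=
  WithLp.toLp 2 fun n => X n i

/-- The vector with all coordinates equal to one. -/
noncomputable def onesVec (N : ℕ) : EuclideanSpace ℝ (Fin N) := WithLp.toLp 2 fun _ => 1

/-- The span of the constant vector and of the variables in `S`. -/
noncomputable def colSpan (X : Matrix (Fin N) (Fin M) ℝ) (S : Finset (Fin M)) :
    Submodule ℝ (EuclideanSpace ℝ (Fin N)) :=
  ℝ ∙ onesVec N ⊔ Submodule.span ℝ (colVec X '' S)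

lemma colSpan_empty (X : Matrix (Fin N) (Fin M) ℝ) : colSpan X ∅ = ⊥ ⊔ ℝ ∙ onesVec N := by
  simp [colSpan]

lemma colSpan_insert (X : Matrix (Fin N) (Fin M) ℝ) (S : Finset (Fin M)) (s : Fin M) :
    colSpan X (insert s S) = colSpan X S ⊔ ℝ ∙ colVec X s := by
  rw [colSpan, colSpan, Finset.coe_insert, Set.image_insert_eq, Submodule.span_insert,
    sup_assoc, sup_comm (ℝ ∙ colVec X s)]

lemma onesVec_mem_colSpan (X : Matrix (Fin N) (Fin M) ℝ) (S : Finset (Fin M)) :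
    onesVec N ∈ colSpan X S :=
  Submodule.mem_sup_left (Submodule.mem_span_singleton_self _)

/-- The indicator vector of the class `j`, scaled to norm one; zero if the class is empty. -/
noncomputable def classVec (y : Fin N → Fin J) (j : Fin J) : EuclideanSpace ℝ (Fin N) :=
  WithLp.toLp 2 fun n => if y n = j then (√(classSize y j))⁻¹ else 0

/-- The coordinates of a vector along the normalized class indicators. Its squared norm is the
squared norm of the projection onto the span of the class indicators. -/
noncomputable def classCoord (y : Fin N → Fin J) :
    EuclideanSpace ℝ (Fin N) →ₗ[ℝ] EuclideanSpace ℝ (Fin J) where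
  toFun v := WithLp.toLp 2 fun j => ⟪classVec y j, v⟫_ℝ
  map_add' v w := by ext j; simp [inner_add_right]
  map_smul' c v := by ext j; simp [inner_smul_right]

lemma norm_sq_classCoord (y : Fin N → Fin J) (v : EuclideanSpace ℝ (Fin N)) :
    ‖classCoord y v‖ ^ 2 = ∑ j, ⟪classVec y j, v⟫_ℝ ^ 2 := by
  rw [EuclideanSpace.real_norm_sq_eq]; rfl

lemma inner_classVec (y : Fin N → Fin J) (j : Fin J) (v : EuclideanSpace ℝ (Fin N)) :
    ⟪classVec y j, v⟫_ℝ =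
      (√(classSize y j))⁻¹ * ∑ n ∈ Finset.univ.filter (fun n => y n = j), v n := by
  rw [Finset.mul_sum, Finset.sum_filter, PiLp.inner_apply]
  refine Finset.sum_congr rfl fun n _ => ?_
  by_cases h : y n = j <;> simp [classVec, h, mul_comm]

lemma norm_classCoord_le (y : Fin N → Fin J) (v : EuclideanSpace ℝ (Fin N)) :
    ‖classCoord y v‖ ≤ ‖v‖ := by
  refine le_of_sq_le_sq ?_ (norm_nonneg v)
  rw [norm_sq_classCoord, EuclideanSpace.real_norm_sq_eq,
    ← Finset.sum_fiberwise_of_maps_to (s := Finset.univ) (t := Finset.univ) (g := y)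
      (fun _ _ => Finset.mem_univ _)]
  refine Finset.sum_le_sum fun j _ => ?_
  rw [inner_classVec, mul_pow, inv_pow, Real.sq_sqrt (Nat.cast_nonneg _)]
  have h := sq_sum_le_card_mul_sum_sq (s := Finset.univ.filter (fun n => y n = j))
    (f := fun n => v n)
  rcases Nat.eq_zero_or_pos (classSize y j) with h0 | h0
  · rw [h0]; simp; exact Finset.sum_nonneg fun _ _ => sq_nonneg _
  · rw [inv_mul_le_iff₀ (by exact_mod_cast h0)]
    exact h

lemma norm_classVec_le (y : Fin N → Fin J) (j : Fin J) : ‖classVec y j‖ ≤ 1 := by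
  have h := norm_classCoord_le y (classVec y j)
  have h2 : ‖classVec y j‖ ^ 2 ≤ ‖classCoord y (classVec y j)‖ := by
    rw [← real_inner_self_eq_norm_sq]
    exact (le_abs_self _).trans (PiLp.norm_apply_le (classCoord y (classVec y j)) j)
  nlinarith [norm_nonneg (classVec y j)]

/-- The square roots of the class sizes are a linear relation between the class indicators and
the constant vector. -/
lemma sum_sqrt_classSize_smul_classVec (y : Fin N → Fin J) :
    ∑ j, √(classSize y j) • classVec y j = onesVec N := by
  ext n
  have : classSize y (y n) ≠ 0 := by
    rw [classSize, Finset.card_ne_zero]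
    exact ⟨n, by simp⟩
  have h2 : √(classSize y (y n) : ℝ) ≠ 0 := by positivity
  simp [classVec, onesVec, Finset.sum_apply, h2]

/-- The centered observations of the variable `i`. -/
noncomputable def centered (X : Matrix (Fin N) (Fin M) ℝ) (i : Fin M) :
    EuclideanSpace ℝ (Fin N) :=
  residual (ℝ ∙ onesVec N) (colVec X i)

lemma centered_apply (X : Matrix (Fin N) (Fin M) ℝ) (S : Finset (Fin M)) (a : S) (n : Fin N) :
    centered X a n = columns X S n a - overallMean (columns X S) a := by
  have h1 : ‖onesVec N‖ ^ 2 = N := by simp [onesVec, EuclideanSpace.real_norm_sq_eq]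
  have h2 : ⟪onesVec N, colVec X a⟫_ℝ = ∑ n, X n a := by
    simp [onesVec, colVec, PiLp.inner_apply]
  rw [centered, residual, Submodule.starProjection_singleton]
  change X n a - ⟪onesVec N, colVec X a⟫_ℝ / ((‖onesVec N‖ ^ 2 : ℝ)) * 1 = _
  rw [h1, h2]
  simp [overallMean, columns]

lemma totalScatter_columns (X : Matrix (Fin N) (Fin M) ℝ) (S : Finset (Fin M)) :
    totalScatter (columns X S) = Matrix.gram ℝ fun a : S => centered X a := by
  ext a b
  simp only [totalScatter, Matrix.sum_apply, Matrix.vecMulVec_apply, Matrix.gram_apply,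
    PiLp.inner_apply, centered_apply, Pi.sub_apply]
  exact Finset.sum_congr rfl fun n _ => by simp [mul_comm]

lemma inner_classVec_centered (y : Fin N → Fin J) (X : Matrix (Fin N) (Fin M) ℝ)
    (S : Finset (Fin M)) (a : S) (j : Fin J) :
    ⟪classVec y j, centered X a⟫_ℝ =
      √(classSize y j) * (classMean y (columns X S) j - overallMean (columns X S)) a := by
  rw [inner_classVec]
  simp only [centered_apply, Finset.sum_sub_distrib, Finset.sum_const, nsmul_eq_mul, Pi.sub_apply,
    classMean]
  change _ * (_ - (classSize y j : ℝ) * _) = _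
  rcases Nat.eq_zero_or_pos (classSize y j) with h0 | h0
  · simp [h0]
  · have h1 : (0 : ℝ) < classSize y j := by exact_mod_cast h0
    have h2 := Real.sq_sqrt h1.le
    have h3 : √(classSize y j : ℝ) ≠ 0 := by positivity
    field_simp
    rw [h2]

lemma betweenScatter_columns (y : Fin N → Fin J) (X : Matrix (Fin N) (Fin M) ℝ)
    (S : Finset (Fin M)) :
    betweenScatter y (columns X S) =
      ∑ j, Matrix.vecMulVec (fun a : S => ⟪centered X a, classVec y j⟫_ℝ)
        (fun a : S => ⟪centered X a, classVec y j⟫_ℝ) := by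
  rw [betweenScatter]
  refine Finset.sum_congr rfl fun j _ => ?_
  ext a b
  simp only [Matrix.smul_apply, Matrix.vecMulVec_apply, real_inner_comm (classVec y j),
    inner_classVec_centered, smul_eq_mul]
  rw [mul_mul_mul_comm, Real.mul_self_sqrt (Nat.cast_nonneg _)]

lemma pillaiOf_eq_sum_centered (y : Fin N → Fin J) (X : Matrix (Fin N) (Fin M) ℝ)
    (S : Finset (Fin M)) (hS : IsUnit (totalScatter (columns X S)).det) :
    pillaiOf y X S =
      ∑ j, ‖(Submodule.span ℝ (Set.range fun a : S => centered X a)).starProjection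
        (classVec y j)‖ ^ 2 := by
  rw [totalScatter_columns] at hS
  rw [pillaiOf, pillai, totalScatter_columns, betweenScatter_columns, Matrix.mul_sum,
    Matrix.trace_sum]
  refine Finset.sum_congr rfl fun j _ => ?_
  rw [norm_sq_starProjection_span_range _ hS, Matrix.mul_vecMulVec, Matrix.trace_vecMulVec,
    dotProduct_comm]

lemma colSpan_eq_sup_centered (X : Matrix (Fin N) (Fin M) ℝ) (S : Finset (Fin M)) :
    colSpan X S = ℝ ∙ onesVec N ⊔ Submodule.span ℝ (Set.range fun a : S => centered X a) := by
  have hc : ∀ i, colVec X i = (ℝ ∙ onesVec N).starProjection (colVec X i) + centered X i := by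
    intro i; rw [centered, residual]; abel
  apply le_antisymm
  · refine sup_le le_sup_left (Submodule.span_le.2 ?_)
    rintro _ ⟨i, hi, rfl⟩
    rw [SetLike.mem_coe, hc]
    exact Submodule.add_mem _ (Submodule.mem_sup_left (Submodule.starProjection_apply_mem _ _))
      (Submodule.mem_sup_right (Submodule.subset_span ⟨⟨i, hi⟩, rfl⟩))
  · refine sup_le le_sup_left (Submodule.span_le.2 ?_)
    rintro _ ⟨i, rfl⟩
    exact Submodule.sub_mem _
      (Submodule.mem_sup_right (Submodule.subset_span ⟨i, i.2, rfl⟩))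
      (Submodule.mem_sup_left (Submodule.starProjection_apply_mem _ _))

/-- Up to a constant, Pillai's trace is the sum of the squared projections of the normalized class
indicators onto the span of the constant vector and the variables. -/
lemma pillaiOf_add (y : Fin N → Fin J) (X : Matrix (Fin N) (Fin M) ℝ)
    (S : Finset (Fin M)) (hS : IsUnit (totalScatter (columns X S)).det) :
    ∑ j, ‖(colSpan X S).starProjection (classVec y j)‖ ^ 2 =
      ∑ j, ‖(ℝ ∙ onesVec N).starProjection (classVec y j)‖ ^ 2 + pillaiOf y X S := by
  rw [pillaiOf_eq_sum_centered y X S hS, ← Finset.sum_add_distrib]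
  refine Finset.sum_congr rfl fun j _ => ?_
  rw [colSpan_eq_sup_centered, norm_sq_starProjection_sup_of_le_orthogonal]
  rw [Submodule.span_le]
  rintro _ ⟨i, rfl⟩
  exact residual_mem_orthogonal _ _

/-- The gain of Pillai's trace when a variable with observations `x` joins the variables `S` (see
`pillaiOf_insert_sub`); zero if `x` lies in the span of `S` and the constant vector. -/
noncomputable def gain (y : Fin N → Fin J) (X : Matrix (Fin N) (Fin M) ℝ) (S : Finset (Fin M))
    (x : EuclideanSpace ℝ (Fin N)) : ℝ :=
  ‖classCoord y (unitVec (residual (colSpan X S) x))‖ ^ 2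

lemma gain_eq_div (y : Fin N → Fin J) (X : Matrix (Fin N) (Fin M) ℝ) (S : Finset (Fin M))
    (x : EuclideanSpace ℝ (Fin N)) :
    gain y X S x =
      ‖classCoord y (residual (colSpan X S) x)‖ ^ 2 / ‖residual (colSpan X S) x‖ ^ 2 := by
  rw [gain, unitVec, map_smul, norm_smul, norm_inv, norm_norm, mul_pow, inv_pow]
  ring

lemma pillaiOf_insert_sub (y : Fin N → Fin J) (X : Matrix (Fin N) (Fin M) ℝ)
    (S : Finset (Fin M)) (i : Fin M) (hS : IsUnit (totalScatter (columns X S)).det)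
    (hiS : IsUnit (totalScatter (columns X (insert i S))).det) :
    pillaiOf y X (insert i S) - pillaiOf y X S = gain y X S (colVec X i) := by
  have h1 := pillaiOf_add y X S hS
  have h2 := pillaiOf_add y X _ hiS
  have h3 : ∑ j, ‖(colSpan X (insert i S)).starProjection (classVec y j)‖ ^ 2 =
      ∑ j, ‖(colSpan X S).starProjection (classVec y j)‖ ^ 2 + gain y X S (colVec X i) := by
    rw [gain, norm_sq_classCoord, ← Finset.sum_add_distrib]
    refine Finset.sum_congr rfl fun j _ => ?_
    rw [colSpan_insert, norm_sq_starProjection_sup_span, real_inner_comm]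
  linarith

lemma isUnit_det_gram_iff {E ι : Type*} [NormedAddCommGroup E] [InnerProductSpace ℝ E] [Fintype ι]
    [DecidableEq ι] (c : ι → E) :
    IsUnit (Matrix.gram ℝ c).det ↔ LinearIndependent ℝ c := by
  rw [← Matrix.isUnit_iff_isUnit_det, ← Matrix.posDef_gram_iff_linearIndependent (𝕜 := ℝ)]
  exact ⟨fun h => (Matrix.posSemidef_gram ℝ c).posDef_iff_isUnit.2 h, fun h => h.isUnit⟩

/-- The total scatter matrix stays invertible when a variable outside the span of the others and
the constant vector is added. -/
lemma isUnit_det_totalScatter_insert (X : Matrix (Fin N) (Fin M) ℝ)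
    (S : Finset (Fin M)) (i : Fin M) (hS : IsUnit (totalScatter (columns X S)).det)
    (hi : residual (colSpan X S) (colVec X i) ≠ 0) :
    IsUnit (totalScatter (columns X (insert i S))).det := by
  rw [totalScatter_columns, isUnit_det_gram_iff] at hS ⊢
  have hS' : LinearIndepOn ℝ (centered X) (S : Set (Fin M)) := hS
  have : LinearIndepOn ℝ (centered X) ((insert i S : Finset (Fin M)) : Set (Fin M)) := by
    rw [Finset.coe_insert]
    refine hS'.insert fun hmem => hi ?_
    rw [residual_eq_zero_iff, colSpan_eq_sup_centered]
    have hc : colVec X i = (ℝ ∙ onesVec N).starProjection (colVec X i) + centered X i := by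
      rw [centered, residual]; abel
    rw [hc]
    refine Submodule.add_mem _ (Submodule.mem_sup_left (Submodule.starProjection_apply_mem _ _))
      (Submodule.mem_sup_right ?_)
    have hr : (Set.range fun a : S => centered X a) = centered X '' S := by
      ext v; simp
    rw [hr]
    exact hmem
  exact this

/-! ### Forward selection with nearly constant gains -/

variable {N J M : ℕ}

/-- The gain depends on the new variable only up to location and scale. -/
lemma gain_smul_add (y : Fin N → Fin J) (X : Matrix (Fin N) (Fin M) ℝ) (S : Finset (Fin M))
    (x : EuclideanSpace ℝ (Fin N)) (m : ℝ) {s : ℝ} (hs : s ≠ 0) :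
    gain y X S (m • onesVec N + s • x) = gain y X S x := by
  rw [gain_eq_div, gain_eq_div, residual_add, residual_smul, residual_smul,
    (residual_eq_zero_iff _ _).2 (onesVec_mem_colSpan X S), smul_zero, zero_add, map_smul,
    norm_smul, norm_smul, mul_pow, mul_pow]
  refine mul_div_mul_left _ _ ?_
  positivity

/-- Each candidate `i` in `S k` was selected at an earlier step `l`, where no other candidate gave a
larger trace. -/
lemma IsForwardSelection.exists_step {y : Fin N → Fin J} {X : Matrix (Fin N) (Fin M) ℝ}
    {A : Finset (Fin M)} {K : ℕ} {S : ℕ → Finset (Fin M)} (hS : IsForwardSelection y X A K S)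
    {k : ℕ} (hk : A.card ≤ k) (hkK : k ≤ K) :
    A ⊆ S k ∧ (S k).card = k ∧ ∀ i ∈ S k, i ∉ A → ∃ l, A.card ≤ l ∧ l < k ∧ A ⊆ S l ∧ S l ⊆ S k ∧
      i ∉ S l ∧ ∀ j, j ∉ S l → pillaiOf y X (insert j (S l)) ≤ pillaiOf y X (insert i (S l)) := by
  induction k, hk using Nat.le_induction with
  | base =>
    rw [hS.1]
    exact ⟨subset_rfl, rfl, fun i hi hiA => absurd hi hiA⟩
  | succ k hk ih =>
    obtain ⟨hsub, hcard, hstep⟩ := ih (by omega)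
    obtain ⟨i, hi, hSi, hmax⟩ := hS.2 k hk (by omega)
    have hle : S k ⊆ S (k + 1) := by rw [hSi]; exact Finset.subset_insert _ _
    refine ⟨hsub.trans hle, by rw [hSi, Finset.card_insert_of_notMem hi, hcard], ?_⟩
    intro j hj hjA
    rw [hSi, Finset.mem_insert] at hj
    rcases hj with rfl | hj
    · exact ⟨k, hk, by omega, hsub, hle, hi, hmax⟩
    · obtain ⟨l, h1, h2, h3, h4, h5, h6⟩ := hstep j hj hjA
      exact ⟨l, h1, by omega, h3, h4.trans hle, h5, h6⟩

lemma isUnit_det_totalScatter_of_subset {X : Matrix (Fin N) (Fin M) ℝ} {A : Finset (Fin M)}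
    (hA : IsUnit (totalScatter (columns X A)).det)
    (hres : ∀ S, A ⊆ S → ∀ i ∉ S, residual (colSpan X S) (colVec X i) ≠ 0)
    (S : Finset (Fin M)) (hAS : A ⊆ S) : IsUnit (totalScatter (columns X S)).det := by
  have key : ∀ B : Finset (Fin M), IsUnit (totalScatter (columns X (A ∪ B))).det := by
    intro B
    induction B using Finset.induction_on with
    | empty => rwa [Finset.union_empty]
    | insert i B _ ih =>
      rw [Finset.union_insert]
      by_cases hi : i ∈ A ∪ B
      · rwa [Finset.insert_eq_of_mem hi]
      · exact isUnit_det_totalScatter_insert X _ i ih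
          (hres _ Finset.subset_union_left i hi)
  have := key S
  rwa [Finset.union_eq_right.2 hAS] at this

/-- If each candidate has, up to an error, the same gain whatever has been selected before it, then
the gain at step `K` is bounded by the largest such gain in any fixed set of `M - K + 1`
candidates: the candidates selected up to step `K` have at least the gain of the last one, and by
counting one of them lies in the fixed set. -/
lemma IsForwardSelection.exists_mem_lt {y : Fin N → Fin J} {X : Matrix (Fin N) (Fin M) ℝ}
    {A : Finset (Fin M)} {K : ℕ} {S : ℕ → Finset (Fin M)} (hS : IsForwardSelection y X A K S)
    (hAK : A.card < K) (hKM : K ≤ M) (hA : IsUnit (totalScatter (columns X A)).det)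
    (hres : ∀ S, A ⊆ S → ∀ i ∉ S, residual (colSpan X S) (colVec X i) ≠ 0)
    {τ : Fin M → ℝ} {ε : ℝ}
    (hτ : ∀ S, A ⊆ S → ∀ i ∉ S, |N * gain y X S (colVec X i) - τ i| < ε)
    {t : ℝ} (ht : t ≤ pillaiOf y X (S K) - pillaiOf y X (S (K - 1)))
    {T : Finset (Fin M)} (hT : Disjoint T A) (hTcard : T.card = M - K + 1) :
    ∃ i ∈ T, N * t - 3 * ε < τ i := by
  obtain ⟨k, rfl⟩ : ∃ k, K = k + 1 := ⟨K - 1, by omega⟩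
  rw [Nat.add_sub_cancel] at ht
  have hunit := isUnit_det_totalScatter_of_subset hA hres
  have hN : (0 : ℝ) ≤ N := Nat.cast_nonneg N
  obtain ⟨hAK', hcardK, -⟩ := hS.exists_step hAK.le le_rfl
  obtain ⟨hAk, -, hstep⟩ := hS.exists_step (k := k) (by omega) (by omega)
  obtain ⟨i₀, hi₀, hSi₀, -⟩ := hS.2 k (by omega) (by omega)
  have hgain₀ : N * t - ε < τ i₀ := by
    have h1 := hτ (S k) hAk i₀ hi₀
    rw [hSi₀, pillaiOf_insert_sub y X _ i₀ (hunit _ hAk)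
      (hunit _ (hAk.trans (Finset.subset_insert _ _)))] at ht
    have h2 := mul_le_mul_of_nonneg_left ht hN
    rw [abs_lt] at h1
    linarith [h1.2]
  have hgain : ∀ i ∈ S (k + 1), i ∉ A → N * t - 3 * ε < τ i := by
    intro i hi hiA
    have hε : 0 < ε := (abs_nonneg _).trans_lt (hτ (S k) hAk i₀ hi₀)
    by_cases hlk : i = i₀
    · subst hlk; linarith
    have hi' : i ∈ S k := by
      rw [hSi₀, Finset.mem_insert] at hi
      exact hi.resolve_left hlk
    obtain ⟨l, -, -, hAl, hlsub, hil, hmax⟩ := hstep i hi' hiA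
    have hi₀l : i₀ ∉ S l := fun h => hi₀ (hlsub h)
    have hle : gain y X (S l) (colVec X i₀) ≤ gain y X (S l) (colVec X i) := by
      rw [← pillaiOf_insert_sub y X _ i (hunit _ hAl)
          (hunit _ (hAl.trans (Finset.subset_insert _ _))),
        ← pillaiOf_insert_sub y X _ i₀ (hunit _ hAl)
          (hunit _ (hAl.trans (Finset.subset_insert _ _)))]
      linarith [hmax i₀ hi₀l]
    have h2 := mul_le_mul_of_nonneg_left hle hN
    have h3 := abs_lt.1 (hτ _ hAl i hil)
    have h4 := abs_lt.1 (hτ _ hAl i₀ hi₀l)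
    linarith [h3.1, h3.2, h4.1, h4.2]
  have hinter : ¬ Disjoint T (S (k + 1) \ A) := by
    intro hdisj
    have h1 : (T ∪ (S (k + 1) \ A) ∪ A).card ≤ M := by
      simpa using Finset.card_le_univ (T ∪ (S (k + 1) \ A) ∪ A)
    rw [Finset.card_union_of_disjoint, Finset.card_union_of_disjoint hdisj,
      Finset.card_sdiff_of_subset hAK', hTcard, hcardK] at h1
    · omega
    · exact Finset.disjoint_union_left.2 ⟨hT, Finset.sdiff_disjoint⟩
  obtain ⟨i, hiT, hi⟩ := Finset.not_disjoint_iff.1 hinter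
  rw [Finset.mem_sdiff] at hi
  exact ⟨i, hiT, hgain i hi.1 hi.2⟩

/-! ### Projections of a standard Gaussian vector -/

section GaussianProjection

variable {E F : Type*} [NormedAddCommGroup E] [InnerProductSpace ℝ E] [FiniteDimensional ℝ E]
  [MeasurableSpace E] [BorelSpace E] [NormedAddCommGroup F] [InnerProductSpace ℝ F]
  [FiniteDimensional ℝ F] [MeasurableSpace F] [BorelSpace F]

lemma stdGaussian_map_adjoint (f : F →ₗᵢ[ℝ] E) :
    (stdGaussian E).map (ContinuousLinearMap.adjoint f.toContinuousLinearMap) =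
      stdGaussian F := by
  have : IsProbabilityMeasure ((stdGaussian E).map
      (ContinuousLinearMap.adjoint f.toContinuousLinearMap)) :=
    Measure.isProbabilityMeasure_map (by fun_prop)
  apply Measure.ext_of_charFun
  ext t
  rw [charFun_stdGaussian, charFun_apply, integral_map (by fun_prop)
    (Measurable.aestronglyMeasurable (by fun_prop))]
  simp_rw [ContinuousLinearMap.adjoint_inner_left]
  rw [← charFun_apply, charFun_stdGaussian]
  simp

omit [MeasurableSpace E] [BorelSpace E] [MeasurableSpace F] [BorelSpace F] in
lemma exists_linearIsometry_of_finrank_le (h : Module.finrank ℝ E ≤ Module.finrank ℝ F) :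
    Nonempty (E →ₗᵢ[ℝ] F) := by
  let b := stdOrthonormalBasis ℝ E
  let v : Fin (Module.finrank ℝ E) → F := fun i => stdOrthonormalBasis ℝ F (Fin.castLE h i)
  have hv : Orthonormal ℝ v :=
    (stdOrthonormalBasis ℝ F).orthonormal.comp _ (Fin.castLE_injective h)
  refine ⟨(b.toBasis.constr ℝ v).isometryOfOrthonormal (v := b.toBasis) ?_ ?_⟩
  · simp [b.orthonormal]
  · have : ((b.toBasis.constr ℝ v) ∘ b.toBasis) = v := by
      ext i; simp
    rw [this]; exact hv

/-- The distribution function, with a strict inequality, of the chi-squared law with `d` degrees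
of freedom: the law of the squared norm of a standard Gaussian vector of dimension `d`. -/
noncomputable def chiSqCdf (d : ℕ) (c : ℝ) : ℝ :=
  (stdGaussian (EuclideanSpace ℝ (Fin d))).real {g | ‖g‖ ^ 2 < c}

omit [InnerProductSpace ℝ E] [FiniteDimensional ℝ E] in
lemma measurableSet_norm_sq_lt (c : ℝ) : MeasurableSet {z : E | ‖z‖ ^ 2 < c} :=
  measurableSet_lt (by fun_prop) measurable_const

/-- The squared norm of a projection of rank at most `d` is stochastically smaller than a
chi-squared variable with `d` degrees of freedom. -/
lemma chiSqCdf_le_starProjection (U : Submodule ℝ E) {d : ℕ} (hd : Module.finrank ℝ U ≤ d)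
    (c : ℝ) : chiSqCdf d c ≤ (stdGaussian E).real {z | ‖U.starProjection z‖ ^ 2 < c} := by
  obtain ⟨φ⟩ := exists_linearIsometry_of_finrank_le (E := U) (F := EuclideanSpace ℝ (Fin d))
    (by simpa only [finrank_euclideanSpace, Fintype.card_fin] using hd)
  have h1 := stdGaussian_map_adjoint φ
  have h2 := stdGaussian_map_adjoint U.subtypeₗᵢ
  calc chiSqCdf d c
      ≤ (stdGaussian (EuclideanSpace ℝ (Fin d))).real
          (ContinuousLinearMap.adjoint φ.toContinuousLinearMap ⁻¹' {u | ‖u‖ ^ 2 < c}) := by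
        refine measureReal_mono fun g hg => ?_
        have h3 : ‖ContinuousLinearMap.adjoint φ.toContinuousLinearMap g‖ ≤ ‖g‖ := by
          refine (ContinuousLinearMap.le_opNorm _ _).trans ?_
          rw [LinearIsometryEquiv.norm_map]
          exact mul_le_of_le_one_left (norm_nonneg _) φ.norm_toContinuousLinearMap_le
        exact (pow_le_pow_left₀ (norm_nonneg _) h3 2).trans_lt hg
    _ = (stdGaussian U).real {u | ‖u‖ ^ 2 < c} := by
        rw [← h1, map_measureReal_apply (by fun_prop) (measurableSet_norm_sq_lt c)]
    _ = (stdGaussian E).real {z | ‖U.starProjection z‖ ^ 2 < c} := by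
        rw [← h2, map_measureReal_apply (by fun_prop) (measurableSet_norm_sq_lt c)]
        congr 1
        ext z
        have : ContinuousLinearMap.adjoint U.subtypeₗᵢ.toContinuousLinearMap z =
            U.orthogonalProjectionOnto z :=
          congrArg (fun f => f z) U.adjoint_subtypeL
        simp only [Set.mem_preimage, Set.mem_ofPred_eq, this, Submodule.starProjection_apply]
        rfl

/-- Expected squared component of a standard Gaussian vector. -/
lemma lintegral_inner_sq_stdGaussian (e : E) :
    ∫⁻ z, ENNReal.ofReal (⟪e, z⟫_ℝ ^ 2) ∂(stdGaussian E) = ENNReal.ofReal (‖e‖ ^ 2) := by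
  have h1 := variance_dual_stdGaussian (E := E) (innerSL ℝ e)
  have h2 : MemLp (innerSL ℝ e) 2 (stdGaussian E) :=
    IsGaussian.memLp_dual (stdGaussian E) (innerSL ℝ e) 2 (by simp)
  rw [variance_of_integral_eq_zero h2.aemeasurable (integral_strongDual_stdGaussian _),
    innerSL_apply_norm] at h1
  rw [← h1, ofReal_integral_eq_lintegral_ofReal h2.integrable_sq (ae_of_all _ fun _ => sq_nonneg _)]
  rfl

end GaussianProjection

section ClassCoordinates

variable {N J : ℕ}

lemma inner_classVec_residual (y : Fin N → Fin J) (U : Submodule ℝ (EuclideanSpace ℝ (Fin N)))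
    (j : Fin J) (z : EuclideanSpace ℝ (Fin N)) :
    ⟪classVec y j, residual U z⟫_ℝ = ⟪residual U (classVec y j), z⟫_ℝ :=
  (inner_residual_comm _ _ _).symm

/-- After removal of the constant vector the class indicators satisfy a linear relation. -/
lemma finrank_span_residual_classVec_le (hN : N ≠ 0) (y : Fin N → Fin J)
    {U : Submodule ℝ (EuclideanSpace ℝ (Fin N))} (hU : onesVec N ∈ U) :
    Module.finrank ℝ (Submodule.span ℝ (Set.range fun j => residual U (classVec y j))) ≤ J - 1 := by
  have hrel : ∑ j, √(classSize y j) • residual U (classVec y j) = 0 := by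
    rw [← (residual_eq_zero_iff U _).2 hU, ← sum_sqrt_classSize_smul_classVec y]
    simp only [residual, map_sum, smul_sub, map_smul, Finset.sum_sub_distrib]
  -- The class of some observation is not empty; its indicator is expressed by the others.
  let n₀ : Fin N := ⟨0, Nat.pos_of_ne_zero hN⟩
  set j₀ := y n₀ with hj₀
  have hpos : √(classSize y j₀ : ℝ) ≠ 0 := by
    have : classSize y j₀ ≠ 0 := by
      rw [classSize, Finset.card_ne_zero]
      exact ⟨n₀, by simp [hj₀]⟩
    positivity
  set W := Submodule.span ℝ (((Finset.univ.erase j₀).image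
    fun j => residual U (classVec y j) : Finset (EuclideanSpace ℝ (Fin N))) :
      Set (EuclideanSpace ℝ (Fin N))) with hW
  have hmem : ∀ j, j ≠ j₀ → residual U (classVec y j) ∈ W := fun j hj =>
    Submodule.subset_span (Finset.mem_coe.2
      (Finset.mem_image.2 ⟨j, Finset.mem_erase.2 ⟨hj, Finset.mem_univ _⟩, rfl⟩))
  have hle : Submodule.span ℝ (Set.range fun j => residual U (classVec y j)) ≤ W := by
    rw [Submodule.span_le]
    rintro _ ⟨j, rfl⟩
    by_cases hj : j = j₀
    · subst hj
      rw [← Finset.add_sum_erase _ _ (Finset.mem_univ j₀)] at hrel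
      have h1 : residual U (classVec y j₀) = (√(classSize y j₀ : ℝ))⁻¹ •
          -∑ j ∈ Finset.univ.erase j₀, √(classSize y j) • residual U (classVec y j) := by
        rw [← eq_neg_of_add_eq_zero_left hrel, smul_smul, inv_mul_cancel₀ hpos, one_smul]
      change residual U (classVec y j₀) ∈ W
      rw [h1]
      refine Submodule.smul_mem _ _ (Submodule.neg_mem _ (Submodule.sum_mem _ fun j hj => ?_))
      exact Submodule.smul_mem _ _ (hmem j (Finset.ne_of_mem_erase hj))
    · exact hmem j hj
  calc _ ≤ Module.finrank ℝ W := Submodule.finrank_mono hle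
    _ ≤ _ := (finrank_span_finset_le_card _).trans Finset.card_image_le
    _ = J - 1 := by simp

/-- The class components of the residual of a standard Gaussian vector have a squared norm that is
stochastically smaller than a chi-squared variable with `J - 1` degrees of freedom. -/
lemma chiSqCdf_le_classCoord_residual (hN : N ≠ 0) (y : Fin N → Fin J)
    {U : Submodule ℝ (EuclideanSpace ℝ (Fin N))} (hU : onesVec N ∈ U) (c : ℝ) :
    chiSqCdf (J - 1) c ≤ (stdGaussian (EuclideanSpace ℝ (Fin N))).real
      {z | ‖classCoord y (residual U z)‖ ^ 2 < c} := by
  set L := Submodule.span ℝ (Set.range fun j => residual U (classVec y j)) with hL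
  refine (chiSqCdf_le_starProjection L (finrank_span_residual_classVec_le hN y hU) c).trans
    (measureReal_mono fun z hz => ?_)
  change ‖L.starProjection z‖ ^ 2 < c at hz
  change ‖classCoord y (residual U z)‖ ^ 2 < c
  refine lt_of_le_of_lt ?_ hz
  have h1 : classCoord y (residual U z) = classCoord y (residual U (L.starProjection z)) := by
    ext j
    change ⟪classVec y j, residual U z⟫_ℝ = ⟪classVec y j, residual U (L.starProjection z)⟫_ℝ
    rw [inner_classVec_residual, inner_classVec_residual, ← L.inner_starProjection_left_eq_right,
      (Submodule.starProjection_eq_self_iff).2 (Submodule.subset_span (Set.mem_range_self j))]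
  rw [h1]
  exact pow_le_pow_left₀ (norm_nonneg _)
    ((norm_classCoord_le _ _).trans (norm_residual_le _ _)) 2

end ClassCoordinates

/-! ### The chi-squared limit of the Beta threshold -/

section Density

variable {F : Type*} [NormedAddCommGroup F] [InnerProductSpace ℝ F] [FiniteDimensional ℝ F]
  [MeasurableSpace F] [BorelSpace F]

/-- The density of the standard Gaussian measure of dimension `d` as a function of the norm. -/
noncomputable def gaussianDensity (d : ℕ) (r : ℝ) : ℝ :=
  (2 * Real.pi) ^ (-(d / 2 : ℝ)) * Real.exp (-(1 / 2) * r ^ 2)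

lemma gaussianDensity_nonneg (d : ℕ) (r : ℝ) : 0 ≤ gaussianDensity d r := by
  unfold gaussianDensity; positivity

lemma continuous_gaussianDensity (d : ℕ) : Continuous (gaussianDensity d) := by
  unfold gaussianDensity; fun_prop

lemma integral_gaussianDensity_norm :
    ∫ x : F, gaussianDensity (Module.finrank ℝ F) ‖x‖ = 1 := by
  simp only [gaussianDensity]
  rw [integral_const_mul, GaussianFourier.integral_rexp_neg_mul_sq_norm (by norm_num),
    Real.rpow_neg (by positivity), show Real.pi / (1 / 2) = 2 * Real.pi by ring]
  exact inv_mul_cancel₀ (by positivity)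

lemma integrable_gaussianDensity_norm :
    Integrable fun x : F => gaussianDensity (Module.finrank ℝ F) ‖x‖ := by
  by_contra h
  have := integral_undef h
  rw [integral_gaussianDensity_norm] at this
  exact one_ne_zero this

lemma stdGaussian_eq_withDensity :
    stdGaussian F = volume.withDensity
      fun x => ENNReal.ofReal (gaussianDensity (Module.finrank ℝ F) ‖x‖) := by
  have hmeas : Measurable fun x : F => gaussianDensity (Module.finrank ℝ F) ‖x‖ :=
    ((continuous_gaussianDensity _).comp continuous_norm).measurable
  have : IsFiniteMeasure ((volume : Measure F).withDensity
      fun x => ENNReal.ofReal (gaussianDensity (Module.finrank ℝ F) ‖x‖)) :=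
    isFiniteMeasure_withDensity_ofReal integrable_gaussianDensity_norm.2
  apply Measure.ext_of_charFun
  ext t
  rw [charFun_stdGaussian, charFun_apply,
    integral_withDensity_eq_integral_toReal_smul (by fun_prop) (ae_of_all _ fun _ => by simp)]
  have hpt : ∀ x : F, (ENNReal.ofReal (gaussianDensity (Module.finrank ℝ F) ‖x‖)).toReal •
      Complex.exp (⟪x, t⟫_ℝ * Complex.I) =
      ((2 * Real.pi) ^ (-(Module.finrank ℝ F / 2 : ℝ)) : ℝ) *
        Complex.exp (-(1 / 2 : ℂ) * ‖x‖ ^ 2 + Complex.I * ⟪t, x⟫_ℝ) := by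
    intro x
    rw [ENNReal.toReal_ofReal (gaussianDensity_nonneg _ _), Complex.real_smul, gaussianDensity,
      Complex.ofReal_mul, mul_assoc, Complex.ofReal_exp, ← Complex.exp_add, real_inner_comm]
    congr 2
    push_cast
    ring
  simp_rw [hpt]
  rw [integral_const_mul, GaussianFourier.integral_cexp_neg_mul_sq_norm_add (by norm_num),
    show ((Real.pi : ℂ) / (1 / 2)) = ((2 * Real.pi : ℝ) : ℂ) by push_cast; ring,
    show ((Module.finrank ℝ F : ℂ) / 2) = ((Module.finrank ℝ F / 2 : ℝ) : ℂ) by push_cast; ring,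
    ← Complex.ofReal_cpow (by positivity), ← mul_assoc, ← Complex.ofReal_mul,
    Real.rpow_neg (by positivity), inv_mul_cancel₀ (by positivity)]
  simp
  ring_nf

end Density

section Kernels

/-- The unnormalized density of a chi-squared variable with `2 * a` degrees of freedom. -/
noncomputable def chiSqKernel (a s : ℝ) : ℝ := s ^ (a - 1) * Real.exp (-(s / 2))

/-- The unnormalized density of `n` times a Beta variable with parameters `a`, `b`. -/
noncomputable def betaKernel (a b n s : ℝ) : ℝ :=
  if s < n then s ^ (a - 1) * (1 - s / n) ^ (b - 1) else 0

lemma integrableOn_chiSqKernel {a : ℝ} (ha : 0 < a) :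
    IntegrableOn (chiSqKernel a) (Set.Ioi 0) := by
  have := integrableOn_rpow_mul_exp_neg_mul_rpow (s := a - 1) (p := 1) (b := 1 / 2)
    (by linarith) one_pos (by norm_num)
  refine this.congr_fun (fun s _ => ?_) measurableSet_Ioi
  simp only [chiSqKernel, Real.rpow_one]
  ring_nf

lemma integral_chiSqKernel_pos {a : ℝ} (ha : 0 < a) :
    0 < ∫ s in Set.Ioi 0, chiSqKernel a s := by
  have h := Real.integral_rpow_mul_exp_neg_mul_Ioi ha (r := 1 / 2) (by norm_num)
  have h2 : ∫ s in Set.Ioi 0, chiSqKernel a s = (1 / (1 / 2)) ^ a * Real.Gamma a := by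
    rw [← h]
    congr 1; ext s; simp only [chiSqKernel]; ring_nf
  rw [h2]
  have := Real.Gamma_pos_of_pos ha
  positivity

/-- The law of the squared norm of a standard Gaussian vector, up to the normalizing constant. -/
lemma exists_integral_indicator_chiSqKernel {d : ℕ} (hd : d ≠ 0) :
    ∃ C : ℝ, ∀ S : Set ℝ, MeasurableSet S →
      (stdGaussian (EuclideanSpace ℝ (Fin d))).real {g | ‖g‖ ^ 2 ∈ S} =
        C * ∫ s in Set.Ioi 0, S.indicator (chiSqKernel (d / 2)) s := by
  have : Nonempty (Fin d) := ⟨⟨0, Nat.pos_of_ne_zero hd⟩⟩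
  have : Nontrivial (EuclideanSpace ℝ (Fin d)) := by infer_instance
  set E := EuclideanSpace ℝ (Fin d)
  have hE : Module.finrank ℝ E = d := by simp [E]
  refine ⟨d * (volume : Measure E).real (Metric.ball 0 1) *
    ((2 * Real.pi) ^ (-(d / 2 : ℝ)) * 2⁻¹), fun S hS => ?_⟩
  have hS' : MeasurableSet {g : E | ‖g‖ ^ 2 ∈ S} :=
    measurableSet_preimage (by fun_prop) hS
  have h1 : (stdGaussian E).real {g | ‖g‖ ^ 2 ∈ S} =
      ∫ x : E, ((fun r => r ^ 2) ⁻¹' S).indicator (gaussianDensity d) ‖x‖ := by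
    rw [measureReal_def, stdGaussian_eq_withDensity, withDensity_apply _ hS',
      ← integral_eq_lintegral_of_nonneg_ae (ae_of_all _ fun _ => gaussianDensity_nonneg _ _)
        (((continuous_gaussianDensity _).comp continuous_norm).aestronglyMeasurable),
      ← integral_indicator hS', hE]
    rfl
  have hsub := integral_comp_rpow_Ioi_of_pos (g := S.indicator (chiSqKernel ((d : ℝ) / 2))) (p := 2)
    (by norm_num)
  suffices hrad : ∫ x in Set.Ioi (0 : ℝ),
      x ^ (d - 1) • ((fun r => r ^ 2) ⁻¹' S).indicator (gaussianDensity d) x =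
      ((2 * Real.pi) ^ (-(d / 2 : ℝ)) * 2⁻¹) *
        ∫ s in Set.Ioi 0, S.indicator (chiSqKernel (d / 2)) s by
    rw [h1, integral_fun_norm_addHaar (volume : Measure E), hE, hrad, nsmul_eq_mul, smul_eq_mul]
    ring
  rw [← hsub, ← integral_const_mul]
  refine setIntegral_congr_fun measurableSet_Ioi fun x (hx : 0 < x) => ?_
  simp only [smul_eq_mul, Real.rpow_two]
  by_cases hxS : x ^ 2 ∈ S
  · rw [Set.indicator_of_mem hxS, Set.indicator_of_mem (show x ∈ (fun r => r ^ 2) ⁻¹' S from hxS),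
      gaussianDensity, chiSqKernel, ← Real.rpow_natCast x 2, ← Real.rpow_mul hx.le,
      ← Real.rpow_natCast x (d - 1), Nat.cast_sub (Nat.one_le_iff_ne_zero.2 hd)]
    have : x ^ ((d : ℝ) - (1 : ℕ)) = x ^ ((2 : ℝ) - 1) * x ^ (((2 : ℕ) : ℝ) * (d / 2 - 1)) := by
      rw [← Real.rpow_add hx]
      congr 1
      push_cast
      ring
    rw [this, show -(1 / 2) * x ^ ((2 : ℕ) : ℝ) = -(x ^ ((2 : ℕ) : ℝ) / 2) by ring]
    ring
  · rw [Set.indicator_of_notMem hxS,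
      Set.indicator_of_notMem (show x ∉ (fun r => r ^ 2) ⁻¹' S from hxS)]
    simp

lemma chiSqCdf_eq_div {d : ℕ} (hd : d ≠ 0) (c : ℝ) :
    chiSqCdf d c = (∫ s in Set.Ioi 0, (Set.Iio c).indicator (chiSqKernel (d / 2)) s) /
      ∫ s in Set.Ioi 0, chiSqKernel (d / 2) s := by
  obtain ⟨C, hC⟩ := exists_integral_indicator_chiSqKernel hd
  have h1 := hC Set.univ MeasurableSet.univ
  simp only [Set.mem_univ, Set.indicator_univ] at h1
  rw [show {g : EuclideanSpace ℝ (Fin d) | True} = Set.univ from Set.eq_univ_of_forall fun _ =>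
    trivial, probReal_univ] at h1
  have hpos := integral_chiSqKernel_pos (a := (d : ℝ) / 2) (by positivity)
  rw [eq_div_iff hpos.ne', chiSqCdf]
  have h2 := hC (Set.Iio c) measurableSet_Iio
  rw [show {g : EuclideanSpace ℝ (Fin d) | ‖g‖ ^ 2 < c} = {g | ‖g‖ ^ 2 ∈ Set.Iio c} from rfl, h2]
  rw [mul_right_comm, ← h1, one_mul]

/-- The law of `n` times a Beta variable, up to the normalizing constant. -/
lemma exists_betaMeasure_preimage {a b n : ℝ} (ha : 0 < a) (hb : 0 < b) (hn : 0 < n) :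
    ∃ C : ℝ, ∀ S : Set ℝ, MeasurableSet S →
      (betaMeasure a b).real ((fun u => n * u) ⁻¹' S) =
        C * ∫ s in Set.Ioi 0, S.indicator (betaKernel a b n) s := by
  refine ⟨(1 / beta a b) * (n ^ (a - 1))⁻¹ * n⁻¹, fun S hS => ?_⟩
  have hS' : MeasurableSet ((fun u => n * u) ⁻¹' S) := hS.preimage (by fun_prop)
  have hnonneg : ∀ x, 0 ≤ betaPDFReal a b x := by
    intro x
    by_cases hx : 0 < x ∧ x < 1
    · exact (betaPDFReal_pos hx.1 hx.2 ha hb).le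
    · rw [betaPDFReal, if_neg hx]
  have h1 : (betaMeasure a b).real ((fun u => n * u) ⁻¹' S) =
      ∫ x in Set.Ioi 0, ((fun u => n * u) ⁻¹' S).indicator (betaPDFReal a b) x := by
    rw [measureReal_def, betaMeasure, withDensity_apply _ hS']
    simp only [betaPDF]
    rw [← integral_eq_lintegral_of_nonneg_ae (ae_of_all _ hnonneg)
        ((measurable_betaPDFReal a b).aestronglyMeasurable),
      ← integral_indicator hS', ← integral_indicator measurableSet_Ioi]
    congr 1
    ext x
    by_cases hx : x ∈ Set.Ioi (0 : ℝ)
    · rw [Set.indicator_of_mem hx]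
    · rw [Set.indicator_of_notMem hx]
      refine Set.indicator_apply_eq_zero.2 fun _ => ?_
      rw [betaPDFReal, if_neg fun h => hx h.1]
  have h2 := integral_comp_mul_left_Ioi' (S.indicator (betaKernel a b n)) 0 hn
  rw [mul_zero, smul_eq_mul] at h2
  rw [h1, ← h2, mul_assoc, ← mul_assoc n⁻¹, inv_mul_cancel₀ hn.ne', one_mul, ← integral_const_mul]
  refine setIntegral_congr_fun measurableSet_Ioi fun x (hx : 0 < x) => ?_
  by_cases hxS : n * x ∈ S
  · rw [Set.indicator_of_mem hxS, Set.indicator_of_mem (show x ∈ (fun u => n * u) ⁻¹' S from hxS),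
      betaPDFReal, betaKernel]
    by_cases hx1 : x < 1
    · rw [if_pos ⟨hx, hx1⟩, if_pos (by nlinarith), Real.mul_rpow hn.le hx.le,
        mul_div_cancel_left₀ _ hn.ne']
      have : n ^ (a - 1) ≠ 0 := by positivity
      field_simp
    · rw [if_neg fun h => hx1 h.2, if_neg (by nlinarith), mul_zero]
  · rw [Set.indicator_of_notMem hxS,
      Set.indicator_of_notMem (show x ∉ (fun u => n * u) ⁻¹' S from hxS), mul_zero]

lemma betaMeasure_Iic_eq_div {a b n : ℝ} (ha : 0 < a) (hb : 0 < b) (hn : 0 < n) (c : ℝ) :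
    (betaMeasure a b).real (Set.Iic (c / n)) =
      (∫ s in Set.Ioi 0, (Set.Iic c).indicator (betaKernel a b n) s) /
        ∫ s in Set.Ioi 0, betaKernel a b n s := by
  have := isProbabilityMeasureBeta ha hb
  obtain ⟨C, hC⟩ := exists_betaMeasure_preimage ha hb hn
  have h1 := hC Set.univ MeasurableSet.univ
  simp only [Set.preimage_univ, Set.indicator_univ, probReal_univ] at h1
  have h0 : ∫ s in Set.Ioi 0, betaKernel a b n s ≠ 0 := fun h => by simp [h] at h1
  have h2 := hC (Set.Iic c) measurableSet_Iic
  have h3 : (fun u => n * u) ⁻¹' Set.Iic c = Set.Iic (c / n) := by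
    ext u; simp [le_div_iff₀ hn, mul_comm]
  rw [h3] at h2
  rw [eq_div_iff h0, h2, mul_right_comm, ← h1, one_mul]

end Kernels

section Limit

/-- Pointwise convergence of the unnormalized densities, along `b = (n - J) / 2`. -/
lemma tendsto_betaKernel (a J s : ℝ) :
    Tendsto (fun n => betaKernel a ((n - J) / 2) n s) atTop (𝓝 (chiSqKernel a s)) := by
  have h1 : Tendsto (fun x : ℝ => (1 + -(s / (2 * x + J + 2))) ^ x) atTop
      (𝓝 (Real.exp (-(s / 2)))) := by
    apply Real.tendsto_one_add_rpow_exp_of_tendsto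
    have h2 : Tendsto (fun x : ℝ => 2 + (J + 2) / x) atTop (𝓝 (2 + 0)) :=
      tendsto_const_nhds.add (tendsto_const_nhds.div_atTop tendsto_id)
    rw [add_zero] at h2
    have h3 : Tendsto (fun x : ℝ => -(s / (2 + (J + 2) / x))) atTop (𝓝 (-(s / 2))) :=
      (tendsto_const_nhds.div h2 two_ne_zero).neg
    refine h3.congr' ?_
    filter_upwards [eventually_gt_atTop 0, eventually_gt_atTop (-(J + 2))] with x hx hx2
    rw [show 2 + (J + 2) / x = (2 * x + J + 2) / x by field_simp; ring, div_div_eq_mul_div]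
    ring
  have h2 : Tendsto (fun n : ℝ => (n - J) / 2 - 1) atTop atTop :=
    tendsto_atTop_add_const_right _ _
      ((tendsto_atTop_add_const_right _ _ tendsto_id).atTop_div_const two_pos)
  have h3 := (h1.comp h2).const_mul (s ^ (a - 1))
  refine h3.congr' ?_
  filter_upwards [eventually_gt_atTop s] with n hn
  rw [betaKernel, if_pos hn]
  simp only [Function.comp]
  rw [show 2 * ((n - J) / 2 - 1) + J + 2 = n by ring, ← sub_eq_add_neg]

/-- An integrable bound that does not depend on `n`. -/
lemma norm_betaKernel_le (a : ℝ) {J n s : ℝ} (hs : 0 < s) (hn : 2 * J + 4 ≤ n) (hn0 : 0 < n) :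
    ‖betaKernel a ((n - J) / 2) n s‖ ≤ s ^ (a - 1) * Real.exp (-(1 / 4) * s ^ (1 : ℝ)) := by
  rw [betaKernel]
  by_cases hsn : s < n
  · have h0 : 0 ≤ 1 - s / n := by
      rw [sub_nonneg, div_le_one hn0]; exact hsn.le
    rw [if_pos hsn, Real.norm_of_nonneg (mul_nonneg (Real.rpow_nonneg hs.le _)
      (Real.rpow_nonneg h0 _))]
    refine mul_le_mul_of_nonneg_left ?_ (Real.rpow_nonneg hs.le _)
    have h1 : 1 - s / n ≤ Real.exp (-(s / n)) := by
      have := Real.add_one_le_exp (-(s / n)); linarith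
    have h2 : 0 ≤ (n - J) / 2 - 1 := by linarith
    refine (Real.rpow_le_rpow h0 h1 h2).trans ?_
    rw [← Real.exp_mul, Real.rpow_one]
    refine Real.exp_le_exp.2 ?_
    have h3 : 1 / 4 ≤ ((n - J) / 2 - 1) / n := by
      rw [div_le_div_iff₀ (by norm_num) hn0]; linarith
    have h4 : -(s / n) * ((n - J) / 2 - 1) = -s * (((n - J) / 2 - 1) / n) := by ring
    rw [h4]
    nlinarith
  · rw [if_neg hsn, norm_zero]
    positivity

lemma measurable_betaKernel (a b n : ℝ) : Measurable (betaKernel a b n) := by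
  unfold betaKernel
  exact Measurable.ite measurableSet_Iio (by fun_prop) measurable_const

lemma tendsto_integral_indicator_betaKernel {a : ℝ} (ha : 0 < a) (J : ℝ) {S : Set ℝ}
    (hS : MeasurableSet S) :
    Tendsto (fun n => ∫ s in Set.Ioi 0, S.indicator (betaKernel a ((n - J) / 2) n) s) atTop
      (𝓝 (∫ s in Set.Ioi 0, S.indicator (chiSqKernel a) s)) := by
  refine tendsto_integral_filter_of_dominated_convergence
    (fun s => s ^ (a - 1) * Real.exp (-(1 / 4) * s ^ (1 : ℝ))) ?_ ?_ ?_ ?_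
  · exact Eventually.of_forall fun n =>
      ((measurable_betaKernel _ _ _).indicator hS).aestronglyMeasurable
  · filter_upwards [eventually_ge_atTop (2 * J + 4), eventually_gt_atTop 0] with n hn hn0
    filter_upwards [ae_restrict_mem measurableSet_Ioi] with s hs
    exact (norm_indicator_le_norm_self _ _).trans (norm_betaKernel_le a hs hn hn0)
  · exact integrableOn_rpow_mul_exp_neg_mul_rpow (by linarith) one_pos (by norm_num)
  · filter_upwards [ae_restrict_mem measurableSet_Ioi] with s hs
    by_cases hsS : s ∈ S
    · simp only [Set.indicator_of_mem hsS]
      exact tendsto_betaKernel a J s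
    · simp only [Set.indicator_of_notMem hsS]
      exact tendsto_const_nhds

/-- `N` times a Beta variable with parameters `(J - 1) / 2` and `(N - J) / 2` converges in law to
a chi-squared variable with `J - 1` degrees of freedom. -/
lemma tendsto_betaMeasure_Iic {J : ℕ} (hJ : 2 ≤ J) (c : ℝ) :
    Tendsto (fun N : ℕ => (betaMeasure (((J : ℝ) - 1) / 2) (((N : ℝ) - J) / 2)).real
      (Set.Iic (c / N))) atTop (𝓝 (chiSqCdf (J - 1) c)) := by
  have hJ' : ((J - 1 : ℕ) : ℝ) = (J : ℝ) - 1 := by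
    rw [Nat.cast_sub (by omega), Nat.cast_one]
  have hJ2 : (2 : ℝ) ≤ J := by exact_mod_cast hJ
  have ha : 0 < ((J : ℝ) - 1) / 2 := by linarith
  have h1 := tendsto_integral_indicator_betaKernel ha (J : ℝ) (S := Set.Iic c) measurableSet_Iic
  have h2 := tendsto_integral_indicator_betaKernel ha (J : ℝ) (S := Set.univ) MeasurableSet.univ
  simp only [Set.indicator_univ] at h2
  have h3 := (h1.div h2 (integral_chiSqKernel_pos ha).ne').comp tendsto_natCast_atTop_atTop
  have h4 : (∫ s in Set.Ioi 0, (Set.Iic c).indicator (chiSqKernel (((J : ℝ) - 1) / 2)) s) =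
      ∫ s in Set.Ioi 0, (Set.Iio c).indicator (chiSqKernel (((J : ℝ) - 1) / 2)) s :=
    integral_congr_ae (ae_restrict_of_ae (indicator_ae_eq_of_ae_eq_set Iio_ae_eq_Iic.symm))
  rw [chiSqCdf_eq_div (by omega), hJ', ← h4]
  refine h3.congr' ?_
  filter_upwards [eventually_gt_atTop J] with N hN
  have hN' : (J : ℝ) < N := by exact_mod_cast hN
  rw [betaMeasure_Iic_eq_div ha (by linarith) (by linarith)]
  rfl

lemma continuous_chiSqCdf {d : ℕ} (hd : d ≠ 0) : Continuous (chiSqCdf d) := by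
  have ha : 0 < (d : ℝ) / 2 := by positivity
  set w := (Set.Ioi (0 : ℝ)).indicator (chiSqKernel (d / 2)) with hw
  have hint : Integrable w := (integrableOn_chiSqKernel ha).integrable_indicator measurableSet_Ioi
  have h : ∀ c, ∫ s in Set.Ioi 0, (Set.Iio c).indicator (chiSqKernel (d / 2)) s =
      (∫ s in Set.Iic 0, w s) + ∫ s in (0 : ℝ)..c, w s := by
    intro c
    rw [← intervalIntegral.integral_Iic_sub_Iic hint.integrableOn hint.integrableOn,
      add_sub_cancel, integral_Iic_eq_integral_Iio, ← integral_indicator measurableSet_Ioi,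
      ← integral_indicator measurableSet_Iio, hw, Set.indicator_indicator, Set.indicator_indicator,
      Set.inter_comm]
  have h2 : chiSqCdf d = fun c => ((∫ s in Set.Iic 0, w s) + ∫ s in (0 : ℝ)..c, w s) /
      ∫ s in Set.Ioi 0, chiSqKernel (d / 2) s := by
    ext c
    rw [chiSqCdf_eq_div hd, h]
  rw [h2]
  exact (continuous_const.add
    (intervalIntegral.continuous_primitive (fun _ _ => hint.intervalIntegrable) 0)).div_const _

lemma chiSqCdf_zero (d : ℕ) : chiSqCdf d 0 = 0 := by
  rw [chiSqCdf]
  convert measureReal_empty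
  ext g
  simp [not_lt.2 (sq_nonneg ‖g‖)]

lemma tendsto_chiSqCdf (d : ℕ) : Tendsto (chiSqCdf d) atTop (𝓝 1) := by
  have h : Tendsto (fun c : ℝ => (stdGaussian (EuclideanSpace ℝ (Fin d))) {g | ‖g‖ ^ 2 < c})
      atTop (𝓝 ((stdGaussian (EuclideanSpace ℝ (Fin d)))
        (⋃ c : ℝ, {g | ‖g‖ ^ 2 < c}))) :=
    tendsto_measure_iUnion_atTop fun a b hab g (hg : ‖g‖ ^ 2 < a) => lt_of_lt_of_le hg hab
  have hU : (⋃ c : ℝ, {g : EuclideanSpace ℝ (Fin d) | ‖g‖ ^ 2 < c}) = Set.univ := by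
    refine Set.eq_univ_of_forall fun g => Set.mem_iUnion.2 ⟨‖g‖ ^ 2 + 1, ?_⟩
    exact lt_add_one (‖g‖ ^ 2)
  rw [hU, measure_univ] at h
  have := (ENNReal.tendsto_toReal ENNReal.one_ne_top).comp h
  rwa [ENNReal.toReal_one] at this

/-- The Beta quantile, scaled by `N`, eventually stays above a point at which the chi-squared
distribution function is nearly `p`, with room to spare. -/
lemma exists_eventually_lt_quantile {J : ℕ} (hJ : 2 ≤ J) {p δ : ℝ} (hp0 : 0 < p) (hp1 : p < 1)
    (hδ : 0 < δ) :
    ∃ c ε : ℝ, 0 < ε ∧ p - δ < chiSqCdf (J - 1) c ∧ ∀ᶠ N : ℕ in atTop,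
      c + ε ≤ N * quantile (betaMeasure (((J : ℝ) - 1) / 2) (((N : ℝ) - J) / 2)) p := by
  have hcont := continuous_chiSqCdf (d := J - 1) (by omega)
  obtain ⟨p', hp'0, hp'δ, hp'p⟩ : ∃ p', 0 < p' ∧ p - δ < p' ∧ p' < p := by
    obtain ⟨p', h1, h2⟩ := exists_between (max_lt hp0 (sub_lt_self p hδ))
    exact ⟨p', (le_max_left _ _).trans_lt h1, (le_max_right _ _).trans_lt h1, h2⟩
  obtain ⟨q, hq⟩ : ∃ q, chiSqCdf (J - 1) q = p' := by
    obtain ⟨b, hb⟩ := ((tendsto_chiSqCdf (J - 1)).eventually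
      (lt_mem_nhds (hp'p.trans hp1))).exists
    exact mem_range_of_exists_le_of_exists_ge hcont ⟨0, by rw [chiSqCdf_zero]; exact hp'0.le⟩
      ⟨b, hb.le⟩
  obtain ⟨c, hcq, hc⟩ : ∃ c, c < q ∧ p - δ < chiSqCdf (J - 1) c := by
    have h := hcont.continuousAt.eventually (lt_mem_nhds (show p - δ < chiSqCdf (J - 1) q by
      rw [hq]; exact hp'δ))
    obtain ⟨l, hl, hl2⟩ := exists_Ioc_subset_of_mem_nhds h (exists_lt q)
    obtain ⟨c, hlc, hcq⟩ := exists_between hl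
    exact ⟨c, hcq, hl2 ⟨hlc, hcq.le⟩⟩
  refine ⟨c, q - c, sub_pos.2 hcq, hc, ?_⟩
  have hlim := (tendsto_betaMeasure_Iic hJ q).eventually (gt_mem_nhds (hq.trans_lt hp'p))
  filter_upwards [hlim, eventually_gt_atTop J] with N hN hNJ
  have hN' : (J : ℝ) < N := by exact_mod_cast hNJ
  have hJ2 : (2 : ℝ) ≤ J := by exact_mod_cast hJ
  have hprob := isProbabilityMeasureBeta (α := ((J : ℝ) - 1) / 2) (β := ((N : ℝ) - J) / 2)
    (by linarith) (by linarith)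
  set ν := betaMeasure (((J : ℝ) - 1) / 2) (((N : ℝ) - J) / 2)
  have hne : {x : ℝ | p ≤ ν.real (Set.Iic x)}.Nonempty := by
    have h1 : Tendsto (fun x : ℝ => ν.real (Set.Iic x)) atTop (𝓝 1) := by
      have := (ENNReal.tendsto_toReal ENNReal.one_ne_top).comp
        (measure_univ (μ := ν) ▸ tendsto_measure_Iic_atTop ν)
      rwa [ENNReal.toReal_one] at this
    obtain ⟨x, hx⟩ := (h1.eventually (lt_mem_nhds hp1)).exists
    exact ⟨x, hx.le⟩
  have hle : q / N ≤ quantile ν p := by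
    refine le_csInf hne fun x hx => le_of_lt ?_
    by_contra! hxq
    change p ≤ ν.real (Set.Iic x) at hx
    exact absurd (hx.trans
      (measureReal_mono (Set.Iic_subset_Iic.2 hxq))) (not_le.2 hN)
  rw [div_le_iff₀ (by linarith)] at hle
  linarith

end Limit

/-! ### Measurability of residuals -/

section Measurability

variable {N J M : ℕ} {Ω : Type*} [MeasurableSpace Ω]

lemma measurable_unitVec {E : Type*} [NormedAddCommGroup E] [InnerProductSpace ℝ E]
    [MeasurableSpace E] [BorelSpace E] [SecondCountableTopology E] {f : Ω → E}
    (hf : Measurable f) : Measurable fun ω => unitVec (f ω) := by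
  unfold unitVec
  exact hf.norm.inv.smul hf

lemma measurable_residual_colSpan {X : Ω → Matrix (Fin N) (Fin M) ℝ} (S : Finset (Fin M))
    (hX : ∀ i ∈ S, Measurable fun ω => colVec (X ω) i) {f : Ω → EuclideanSpace ℝ (Fin N)}
    (hf : Measurable f) : Measurable fun ω => residual (colSpan (X ω) S) (f ω) := by
  induction S using Finset.induction_on generalizing f with
  | empty =>
    simp only [colSpan_empty, residual_sup_span]
    have h0 : ∀ v : EuclideanSpace ℝ (Fin N), residual ⊥ v = v := fun v => by simp [residual]
    simp only [h0]
    exact hf.sub (Measurable.smul_const (measurable_const.inner hf) _)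
  | insert s S _ ih =>
    have hX' : ∀ i ∈ S, Measurable fun ω => colVec (X ω) i :=
      fun i hi => hX i (Finset.mem_insert_of_mem hi)
    have hs := measurable_unitVec (ih hX' (hX s (Finset.mem_insert_self s S)))
    simp only [colSpan_insert, residual_sup_span]
    exact (ih hX' hf).sub (Measurable.fun_smul (hs.inner hf) hs)

lemma measurable_classVec {y : Ω → Fin N → Fin J} (hy : Measurable y) (j : Fin J) :
    Measurable fun ω => classVec (y ω) j :=
  (Measurable.of_discrete (f := fun y : Fin N → Fin J => classVec y j)).comp hy

lemma measurable_norm_classCoord {y : Ω → Fin N → Fin J} (hy : Measurable y)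
    {f : Ω → EuclideanSpace ℝ (Fin N)} (hf : Measurable f) :
    Measurable fun ω => ‖classCoord (y ω) (f ω)‖ := by
  have : (fun ω => ‖classCoord (y ω) (f ω)‖) =
      fun ω => √(∑ j, ⟪classVec (y ω) j, f ω⟫_ℝ ^ 2) := by
    ext ω
    rw [← norm_sq_classCoord, Real.sqrt_sq (norm_nonneg _)]
  rw [this]
  exact (Finset.measurable_sum _ fun j _ =>
    ((measurable_classVec hy j).inner hf).pow_const 2).sqrt

lemma measurableSet_forall_norm_sq_classCoord_lt {X : Ω → Matrix (Fin N) (Fin M) ℝ}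
    {y : Ω → Fin N → Fin J} (hy : Measurable y) {A : Finset (Fin M)}
    (hX : ∀ i ∈ A, Measurable fun ω => colVec (X ω) i) {T : Finset (Fin M)}
    {z : Ω → Fin M → EuclideanSpace ℝ (Fin N)} (hz : ∀ i ∈ T, Measurable fun ω => z ω i) (c : ℝ) :
    MeasurableSet {ω | ∀ i ∈ T,
      ‖classCoord (y ω) (residual (colSpan (X ω) A) (z ω i))‖ ^ 2 < c} := by
  have : {ω | ∀ i ∈ T, ‖classCoord (y ω) (residual (colSpan (X ω) A) (z ω i))‖ ^ 2 < c} =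
      ⋂ i ∈ T, {ω | ‖classCoord (y ω) (residual (colSpan (X ω) A) (z ω i))‖ ^ 2 < c} := by
    ext ω; simp
  rw [this]
  exact Finset.measurableSet_biInter T fun i hi => measurableSet_lt
    ((measurable_norm_classCoord hy (measurable_residual_colSpan A hX (hz i hi))).pow_const 2)
    measurable_const

lemma measurableSet_prod_norm_sq_classCoord_lt {X : Ω → Matrix (Fin N) (Fin M) ℝ}
    {y : Ω → Fin N → Fin J} (hy : Measurable y) {A : Finset (Fin M)}
    (hX : ∀ i ∈ A, Measurable fun ω => colVec (X ω) i) (c : ℝ) :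
    MeasurableSet {p : EuclideanSpace ℝ (Fin N) × Ω |
      ‖classCoord (y p.2) (residual (colSpan (X p.2) A) p.1)‖ ^ 2 < c} :=
  measurableSet_lt ((measurable_norm_classCoord (hy.comp measurable_snd)
    (measurable_residual_colSpan (X := fun p : EuclideanSpace ℝ (Fin N) × Ω => X p.2) A
      (fun k hk => (hX k hk).comp measurable_snd) measurable_fst)).pow_const 2) measurable_const

end Measurability

/-! ### Consequences of independence -/

section Independence

variable {Ω β E : Type*} [MeasurableSpace Ω] [MeasurableSpace β] {P : Measure Ω}
  [IsProbabilityMeasure P] [NormedAddCommGroup E] [InnerProductSpace ℝ E] [FiniteDimensional ℝ E]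
  [MeasurableSpace E] [BorelSpace E]

lemma indepFun_prodMk_right {α γ : Type*} [MeasurableSpace α] [MeasurableSpace γ]
    {f : Ω → α} {g : Ω → β} {h : Ω → γ} (hf : Measurable f) (hg : Measurable g) (hh : Measurable h)
    (hfg : IndepFun f g P) (hfgh : IndepFun (fun ω => (f ω, g ω)) h P) :
    IndepFun f (fun ω => (g ω, h ω)) P := by
  have hgh : IndepFun g h P := hfgh.comp measurable_snd measurable_id
  rw [indepFun_iff_map_prod_eq_prod_map_map (by fun_prop) (by fun_prop)] at hfg hfgh hgh ⊢
  have : IsProbabilityMeasure (P.map f) := Measure.isProbabilityMeasure_map (by fun_prop)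
  have : IsProbabilityMeasure (P.map g) := Measure.isProbabilityMeasure_map (by fun_prop)
  have : IsProbabilityMeasure (P.map h) := Measure.isProbabilityMeasure_map (by fun_prop)
  rw [hgh, ← Measure.prodAssoc_prod, ← hfg, ← hfgh, Measure.map_map (by fun_prop) (by fun_prop)]
  rfl

lemma lintegral_inner_sq_le_one {Z e : Ω → E} (hZ : Measurable Z) (he : Measurable e)
    (hlaw : P.map Z = stdGaussian E) (hind : IndepFun Z e P) (hnorm : ∀ ω, ‖e ω‖ ≤ 1) :
    ∫⁻ ω, ENNReal.ofReal (⟪e ω, Z ω⟫_ℝ ^ 2) ∂P ≤ 1 := by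
  have hmeas : Measurable fun p : E × E => ENNReal.ofReal (⟪p.1, p.2⟫_ℝ ^ 2) := by fun_prop
  have hind' := (indepFun_iff_map_prod_eq_prod_map_map he.aemeasurable hZ.aemeasurable).1 hind.symm
  have : IsProbabilityMeasure (P.map e) := Measure.isProbabilityMeasure_map he.aemeasurable
  calc ∫⁻ ω, ENNReal.ofReal (⟪e ω, Z ω⟫_ℝ ^ 2) ∂P
      = ∫⁻ p, ENNReal.ofReal (⟪p.1, p.2⟫_ℝ ^ 2) ∂(P.map fun ω => (e ω, Z ω)) := by
        rw [lintegral_map hmeas (he.prodMk hZ)]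
    _ = ∫⁻ u, ENNReal.ofReal (‖u‖ ^ 2) ∂(P.map e) := by
        rw [hind', hlaw, lintegral_prod _ hmeas.aemeasurable]
        simp only [lintegral_inner_sq_stdGaussian]
    _ = ∫⁻ ω, ENNReal.ofReal (‖e ω‖ ^ 2) ∂P := by
        rw [lintegral_map (by fun_prop) he]
    _ ≤ ∫⁻ _, 1 ∂P := by
        refine lintegral_mono fun ω => ?_
        rw [ENNReal.ofReal_le_one]
        exact pow_le_one₀ (norm_nonneg _) (hnorm ω)
    _ = 1 := by simp

/-- A bound for the probability of an event under `Z` alone, uniform in the value of an independent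
variable `W`, carries over to the joint law. -/
lemma mul_measure_preimage_le_of_indepFun {α : Type*} [MeasurableSpace α] {Z : Ω → α} {W : Ω → β}
    (hZ : Measurable Z) (hW : Measurable W) (hind : IndepFun Z W P) {G : Set β}
    (hG : MeasurableSet G) {D : Set (α × β)} (hD : MeasurableSet D) {F : ℝ≥0∞}
    (hF : ∀ w, F ≤ P.map Z {z | (z, w) ∈ D}) :
    F * P (W ⁻¹' G) ≤ P {ω | W ω ∈ G ∧ (Z ω, W ω) ∈ D} := by
  have hind' := (indepFun_iff_map_prod_eq_prod_map_map hZ.aemeasurable hW.aemeasurable).1 hind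
  have : IsProbabilityMeasure (P.map W) := Measure.isProbabilityMeasure_map hW.aemeasurable
  have : IsProbabilityMeasure (P.map Z) := Measure.isProbabilityMeasure_map hZ.aemeasurable
  have hGD : MeasurableSet (Prod.snd ⁻¹' G ∩ D : Set (α × β)) :=
    (hG.preimage measurable_snd).inter hD
  calc F * P (W ⁻¹' G) = ∫⁻ w in G, F ∂(P.map W) := by
        rw [setLIntegral_const, Measure.map_apply hW hG]
    _ = ∫⁻ w, G.indicator (fun _ => F) w ∂(P.map W) := (lintegral_indicator hG _).symm
    _ ≤ ∫⁻ w, P.map Z ((fun z => (z, w)) ⁻¹' (Prod.snd ⁻¹' G ∩ D)) ∂(P.map W) := by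
        refine lintegral_mono fun w => ?_
        by_cases hw : w ∈ G
        · rw [Set.indicator_of_mem hw]
          refine (hF w).trans (measure_mono fun z hz => ⟨hw, hz⟩)
        · rw [Set.indicator_of_notMem hw]
          exact zero_le
    _ = P.map (fun ω => (Z ω, W ω)) (Prod.snd ⁻¹' G ∩ D) := by
        rw [hind', Measure.prod_apply_symm hGD]
    _ = P {ω | W ω ∈ G ∧ (Z ω, W ω) ∈ D} := Measure.map_apply (hZ.prodMk hW) hGD

end Independence

/-! ### The candidates under the null hypothesis -/

section Null

variable {Ω : Type*} {N J M : ℕ}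
  {X : Ω → Matrix (Fin N) (Fin M) ℝ} {y : Ω → Fin N → Fin J} {A : Finset (Fin M)}
  {μ : Fin M → ℝ} {v : Fin M → ℝ≥0}

/-- The standardized observations of the variable `i`. -/
noncomputable def stdVec (X : Matrix (Fin N) (Fin M) ℝ) (μ : Fin M → ℝ) (v : Fin M → ℝ≥0)
    (i : Fin M) : EuclideanSpace ℝ (Fin N) :=
  WithLp.toLp 2 fun n => (√(v i))⁻¹ * (X n i - μ i)

lemma colVec_eq_smul_add (X : Matrix (Fin N) (Fin M) ℝ) {i : Fin M} (hi : v i ≠ 0) :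
    colVec X i = μ i • onesVec N + √(v i) • stdVec X μ v i := by
  have : √(v i : ℝ) ≠ 0 := by positivity
  ext n
  simp [colVec, onesVec, stdVec, this]

/-- The events determined by the labels and by all variables other than `i`. -/
@[reducible]
def otherAlgebra (X : Ω → Matrix (Fin N) (Fin M) ℝ) (y : Ω → Fin N → Fin J) (i : Fin M) :
    MeasurableSpace Ω :=
  MeasurableSpace.comap (fun ω => ((fun q : Fin N × {k // k ≠ i} => X ω q.1 q.2), y ω))
    inferInstance

lemma measurable_otherAlgebra_y (i : Fin M) : Measurable[otherAlgebra X y i] y :=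
  (measurable_snd (α := Fin N × {k // k ≠ i} → ℝ) (β := Fin N → Fin J)).comp
    (comap_measurable _)

lemma measurable_otherAlgebra_apply {i k : Fin M} (hk : k ≠ i) (n : Fin N) :
    Measurable[otherAlgebra X y i] fun ω => X ω n k :=
  ((measurable_pi_apply (n, (⟨k, hk⟩ : {k // k ≠ i}))).comp
    (measurable_fst (α := Fin N × {k // k ≠ i} → ℝ) (β := Fin N → Fin J))).comp
    (comap_measurable _)

lemma measurable_colVec_of_apply {m : MeasurableSpace Ω} {k : Fin M}
    (h : ∀ n, Measurable[m] fun ω => X ω n k) : Measurable[m] fun ω => colVec (X ω) k :=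
  (WithLp.measurable_toLp 2 _).comp (measurable_pi_lambda _ h)

lemma measurable_stdVec_of_apply {m : MeasurableSpace Ω} {k : Fin M}
    (h : ∀ n, Measurable[m] fun ω => X ω n k) : Measurable[m] fun ω => stdVec (X ω) μ v k :=
  (WithLp.measurable_toLp 2 _).comp
    (measurable_pi_lambda _ fun n => ((h n).sub_const _).const_mul _)

variable [mΩ : MeasurableSpace Ω] {P : Measure Ω}

namespace IsNull

lemma measurable_stdVec (h : IsNull P X y A μ v) (k : Fin M) :
    Measurable fun ω => stdVec (X ω) μ v k :=
  measurable_stdVec_of_apply fun n => h.measurable_X n k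

lemma measurable_labels (h : IsNull P X y A μ v) : Measurable y :=
  measurable_pi_lambda _ h.measurable_y

lemma otherAlgebra_le (h : IsNull P X y A μ v) (i : Fin M) : otherAlgebra X y i ≤ mΩ := by
  refine Measurable.comap_le ?_
  exact (measurable_pi_lambda _ fun q : Fin N × {k // k ≠ i} =>
    h.measurable_X q.1 q.2).prodMk h.measurable_labels

lemma map_stdVec (h : IsNull P X y A μ v) {i : Fin M} (hi : i ∉ A) (hv : v i ≠ 0) :
    P.map (fun ω => stdVec (X ω) μ v i) = stdGaussian (EuclideanSpace ℝ (Fin N)) := by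
  have hlaw : ∀ n, P.map (fun ω => (√(v i : ℝ))⁻¹ * (X ω n i - μ i)) = gaussianReal 0 1 := by
    intro n
    have h1 : P.map (fun ω => X ω n i) = gaussianReal (μ i) (v i) := (h.normal n i hi).map_eq
    have h2 : (fun ω => (√(v i : ℝ))⁻¹ * (X ω n i - μ i)) =
        (fun x => (√(v i : ℝ))⁻¹ * x) ∘ (fun x => x - μ i) ∘ fun ω => X ω n i := rfl
    have hm := h.measurable_X n i
    rw [h2, ← Measure.map_map (by fun_prop) (by fun_prop),
      ← Measure.map_map (by fun_prop) (by fun_prop), h1, gaussianReal_map_sub_const,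
      gaussianReal_map_const_mul, sub_self, mul_zero]
    congr 1
    ext
    have : (v i : ℝ) ≠ 0 := by exact_mod_cast hv
    simp [inv_pow, this]
  have hind : iIndepFun (fun n ω => (√(v i : ℝ))⁻¹ * (X ω n i - μ i)) P := by
    have h1 := h.indep.precomp (g := fun n : Fin N => (n, (⟨i, hi⟩ : {i // i ∉ A})))
      fun a b hab => (Prod.ext_iff.1 hab).1
    exact h1.comp (fun _ x => (√(v i : ℝ))⁻¹ * (x - μ i)) fun _ => by fun_prop
  have hmeas : ∀ n, Measurable fun ω => (√(v i : ℝ))⁻¹ * (X ω n i - μ i) := fun n =>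
    ((h.measurable_X n i).sub_const _).const_mul _
  have hpi := hind.map_fun_eq_pi_map fun n => (hmeas n).aemeasurable
  simp only [hlaw] at hpi
  rw [← map_pi_eq_stdGaussian, ← hpi, Measure.map_map (by fun_prop) (by fun_prop)]
  rfl

variable [IsProbabilityMeasure P]

/-- A candidate is independent of the labels and of all the other variables. -/
lemma indep_otherAlgebra (h : IsNull P X y A μ v) {i : Fin M} (hi : i ∉ A) :
    Indep (MeasurableSpace.comap (fun ω => stdVec (X ω) μ v i) inferInstance)
      (otherAlgebra X y i) P := by
  classical
  set B₁ : Finset (Fin N × {k // k ∉ A}) := Finset.univ.filter fun q => (q.2 : Fin M) = i with hB₁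
  set B₂ : Finset (Fin N × {k // k ∉ A}) := Finset.univ.filter fun q => (q.2 : Fin M) ≠ i with hB₂
  have hdisj : Disjoint B₁ B₂ := Finset.disjoint_filter_filter_not _ _ _
  set f : Ω → B₁ → ℝ := fun ω q => X ω q.1.1 q.1.2 with hf
  set g : Ω → B₂ → ℝ := fun ω q => X ω q.1.1 q.1.2 with hg
  set k : Ω → (Fin N × {k // k ∈ A} → ℝ) × (Fin N → Fin J) :=
    fun ω => ((fun q => X ω q.1 q.2), y ω) with hk
  have hfm : Measurable f := measurable_pi_lambda _ fun q => h.measurable_X _ _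
  have hgm : Measurable g := measurable_pi_lambda _ fun q => h.measurable_X _ _
  have hkm : Measurable k :=
    (measurable_pi_lambda _ fun q => h.measurable_X _ _).prodMk h.measurable_labels
  have hfg : IndepFun f g P :=
    h.indep.indepFun_finset B₁ B₂ hdisj fun q => h.measurable_X _ _
  have hfgk : IndepFun (fun ω => (f ω, g ω)) k P :=
    h.indep_selected.comp (φ := fun x : Fin N × {k // k ∉ A} → ℝ =>
      ((fun q : B₁ => x q), (fun q : B₂ => x q))) (by fun_prop) measurable_id
  have hall := indepFun_prodMk_right hfm hgm hkm hfg hfgk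
  let φ : (B₁ → ℝ) → EuclideanSpace ℝ (Fin N) := fun x => WithLp.toLp 2 fun n =>
    (√(v i : ℝ))⁻¹ * (x ⟨(n, ⟨i, hi⟩), by simp [hB₁]⟩ - μ i)
  let ψ : (B₂ → ℝ) × ((Fin N × {k // k ∈ A} → ℝ) × (Fin N → Fin J)) →
      (Fin N × {k // k ≠ i} → ℝ) × (Fin N → Fin J) := fun x =>
    (fun q => if hq : (q.2 : Fin M) ∈ A then x.2.1 (q.1, ⟨q.2, hq⟩)
      else x.1 ⟨(q.1, ⟨q.2, hq⟩), by simp [hB₂, q.2.2]⟩, x.2.2)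
  have hφ : Measurable φ := by
    refine (WithLp.measurable_toLp 2 _).comp (measurable_pi_lambda _ fun n => ?_)
    fun_prop
  have hψ : Measurable ψ := by
    refine (measurable_pi_lambda _ fun q => ?_).prodMk (by fun_prop)
    by_cases hq : (q.2 : Fin M) ∈ A
    · simp only [hq, dite_true]; fun_prop
    · simp only [hq, dite_false]; fun_prop
  have hcomp := hall.comp hφ hψ
  have h1 : (φ ∘ f) = fun ω => stdVec (X ω) μ v i := rfl
  have h2 : (ψ ∘ fun ω => (g ω, k ω)) =
      fun ω => ((fun q : Fin N × {k // k ≠ i} => X ω q.1 q.2), y ω) := by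
    ext ω : 1
    refine Prod.ext (funext fun q => ?_) rfl
    simp only [ψ, Function.comp, hg, hk]
    split_ifs <;> rfl
  rw [h1, h2] at hcomp
  exact hcomp

lemma lintegral_inner_stdVec_sq_le_one (h : IsNull P X y A μ v) {i : Fin M} (hi : i ∉ A)
    (hv : v i ≠ 0) {e : Ω → EuclideanSpace ℝ (Fin N)} (he : Measurable[otherAlgebra X y i] e)
    (hnorm : ∀ ω, ‖e ω‖ ≤ 1) :
    ∫⁻ ω, ENNReal.ofReal (⟪e ω, stdVec (X ω) μ v i⟫_ℝ ^ 2) ∂P ≤ 1 :=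
  lintegral_inner_sq_le_one (h.measurable_stdVec i) (he.mono (h.otherAlgebra_le i) le_rfl)
    (h.map_stdVec hi hv) (indep_of_indep_of_le_right (h.indep_otherAlgebra hi) he.comap_le) hnorm

/-- The candidates in `T` have jointly small class components at least as often as independent
chi-squared variables with `J - 1` degrees of freedom would. -/
lemma chiSqCdf_pow_le (h : IsNull P X y A μ v) (hv : ∀ i ∉ A, v i ≠ 0) (hN : N ≠ 0) (c : ℝ)
    (T : Finset (Fin M)) (hT : Disjoint T A) :
    ENNReal.ofReal (chiSqCdf (J - 1) c) ^ T.card ≤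
      P {ω | ∀ i ∈ T, ‖classCoord (y ω) (residual (colSpan (X ω) A) (stdVec (X ω) μ v i))‖ ^ 2
        < c} := by
  induction T using Finset.induction_on with
  | empty => simp
  | insert i T hiT ih =>
    have hiA : i ∉ A := Finset.disjoint_left.1 hT (Finset.mem_insert_self i T)
    have hTA : Disjoint T A := hT.mono_left (Finset.subset_insert i T)
    have hXA : ∀ k ∈ A, Measurable[otherAlgebra X y i] fun ω => colVec (X ω) k := fun k hk =>
      measurable_colVec_of_apply fun n =>
        measurable_otherAlgebra_apply (ne_of_mem_of_not_mem hk hiA) n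
    have hym : Measurable[otherAlgebra X y i] y := measurable_otherAlgebra_y i
    have hG := @measurableSet_forall_norm_sq_classCoord_lt N J M Ω (otherAlgebra X y i) X y hym A
      hXA T (fun ω => stdVec (X ω) μ v) (fun k hk => measurable_stdVec_of_apply fun n =>
        measurable_otherAlgebra_apply (ne_of_mem_of_not_mem hk hiT) n) c
    have hD := @measurableSet_prod_norm_sq_classCoord_lt N J M Ω (otherAlgebra X y i) X y hym A
      hXA c
    have hid : Measurable[mΩ, otherAlgebra X y i] (id : Ω → Ω) :=
      measurable_id'' (h.otherAlgebra_le i)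
    have hind : @IndepFun _ _ _ mΩ _ (otherAlgebra X y i) (fun ω => stdVec (X ω) μ v i) id P := by
      refine (IndepFun_iff_Indep (mγ := otherAlgebra X y i) _ id P).2 ?_
      rw [MeasurableSpace.comap_id]
      exact h.indep_otherAlgebra hiA
    have hF : ∀ ω, ENNReal.ofReal (chiSqCdf (J - 1) c) ≤
        P.map (fun ω => stdVec (X ω) μ v i) {z | (z, ω) ∈ {p : EuclideanSpace ℝ (Fin N) × Ω |
          ‖classCoord (y p.2) (residual (colSpan (X p.2) A) p.1)‖ ^ 2 < c}} := fun ω => by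
      rw [h.map_stdVec hiA (hv i hiA), ENNReal.ofReal_le_iff_le_toReal (measure_ne_top _ _)]
      exact chiSqCdf_le_classCoord_residual hN (y ω) (onesVec_mem_colSpan (X ω) A) c
    have key := @mul_measure_preimage_le_of_indepFun Ω Ω mΩ (otherAlgebra X y i) P _ _ _
      (fun ω => stdVec (X ω) μ v i) id (h.measurable_stdVec i) hid hind _ hG _ hD _ hF
    rw [Finset.card_insert_of_notMem hiT, pow_succ']
    refine (mul_le_mul_right (ih hTA) _).trans (key.trans (measure_mono fun ω hω => ?_))
    intro k hk
    rcases Finset.mem_insert.1 hk with rfl | hk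
    · exact hω.2
    · exact hω.1 k hk

end IsNull

end Null

/-! ### Boundedness and convergence to zero in probability -/

section InProbability

variable {Ω : ℕ → Type*} [∀ N, MeasurableSpace (Ω N)] {P : ∀ N, Measure (Ω N)}
  {f g : ∀ N, Ω N → ℝ}

/-- The sequence `f` is bounded in probability (`O_p(1)`). Each `f N` lives on its own probability
space, and measurability is not assumed. -/
def BddInProb (P : ∀ N, Measure (Ω N)) (f : ∀ N, Ω N → ℝ) : Prop :=
  ∀ η : ℝ≥0∞, 0 < η → ∃ C : ℝ, 0 < C ∧ ∀ᶠ N in atTop, P N {ω | C ≤ |f N ω|} ≤ η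

/-- The sequence `f` converges to zero in probability (`o_p(1)`). Each `f N` lives on its own
probability space, and measurability is not assumed. -/
def NegligibleInProb (P : ∀ N, Measure (Ω N)) (f : ∀ N, Ω N → ℝ) : Prop :=
  ∀ ε : ℝ, 0 < ε → Tendsto (fun N => P N {ω | ε ≤ |f N ω|}) atTop (𝓝 0)

lemma NegligibleInProb.of_le (hg : NegligibleInProb P g)
    (h : ∀ᶠ N in atTop, ∀ ω, |f N ω| ≤ |g N ω|) : NegligibleInProb P f := by
  intro ε hε
  refine tendsto_of_tendsto_of_tendsto_of_le_of_le' tendsto_const_nhds (hg ε hε)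
    (Eventually.of_forall fun _ => zero_le) ?_
  filter_upwards [h] with N hN
  exact measure_mono fun ω (hω : ε ≤ _) => hω.trans (hN ω)

lemma NegligibleInProb.add (hf : NegligibleInProb P f) (hg : NegligibleInProb P g) :
    NegligibleInProb P fun N ω => f N ω + g N ω := by
  intro ε hε
  have h := (hf (ε / 2) (half_pos hε)).add (hg (ε / 2) (half_pos hε))
  rw [add_zero] at h
  refine tendsto_of_tendsto_of_tendsto_of_le_of_le tendsto_const_nhds h
    (fun _ => zero_le) fun N => ?_
  refine (measure_mono ?_).trans (measure_union_le _ _)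
  intro ω (hω : ε ≤ |f N ω + g N ω|)
  by_contra hcon
  simp only [Set.mem_union, Set.mem_ofPred_eq, not_or, not_le] at hcon
  linarith [abs_add_le (f N ω) (g N ω)]

lemma BddInProb.mul (hf : BddInProb P f) (hg : BddInProb P g) :
    BddInProb P fun N ω => f N ω * g N ω := by
  intro η hη
  obtain ⟨C, hC, hf⟩ := hf (η / 2) (ENNReal.half_pos hη.ne')
  obtain ⟨D, hD, hg⟩ := hg (η / 2) (ENNReal.half_pos hη.ne')
  refine ⟨C * D, mul_pos hC hD, ?_⟩
  filter_upwards [hf, hg] with N hfN hgN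
  rw [← ENNReal.add_halves η]
  refine ((measure_mono ?_).trans (measure_union_le _ _)).trans (add_le_add hfN hgN)
  intro ω (hω : C * D ≤ |f N ω * g N ω|)
  by_contra hcon
  simp only [Set.mem_union, Set.mem_ofPred_eq, not_or, not_le] at hcon
  rw [abs_mul] at hω
  exact absurd hω (not_le.2 (mul_lt_mul'' hcon.1 hcon.2 (abs_nonneg _) (abs_nonneg _)))

lemma BddInProb.add (hf : BddInProb P f) (hg : BddInProb P g) :
    BddInProb P fun N ω => f N ω + g N ω := by
  intro η hη
  obtain ⟨C, hC, hf⟩ := hf (η / 2) (ENNReal.half_pos hη.ne')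
  obtain ⟨D, hD, hg⟩ := hg (η / 2) (ENNReal.half_pos hη.ne')
  refine ⟨C + D, add_pos hC hD, ?_⟩
  filter_upwards [hf, hg] with N hfN hgN
  rw [← ENNReal.add_halves η]
  refine ((measure_mono ?_).trans (measure_union_le _ _)).trans (add_le_add hfN hgN)
  intro ω (hω : C + D ≤ |f N ω + g N ω|)
  by_contra hcon
  simp only [Set.mem_union, Set.mem_ofPred_eq, not_or, not_le] at hcon
  linarith [abs_add_le (f N ω) (g N ω)]

lemma NegligibleInProb.mul_bddInProb (hf : NegligibleInProb P f) (hg : BddInProb P g) :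
    NegligibleInProb P fun N ω => f N ω * g N ω := by
  intro ε hε
  rw [ENNReal.tendsto_nhds_zero]
  intro η hη
  obtain ⟨C, hC, hg⟩ := hg (η / 2) (ENNReal.half_pos hη.ne')
  filter_upwards [ENNReal.tendsto_nhds_zero.1 (hf (ε / C) (div_pos hε hC)) (η / 2)
    (ENNReal.half_pos hη.ne'), hg] with N hfN hgN
  rw [← ENNReal.add_halves η]
  refine ((measure_mono ?_).trans (measure_union_le _ _)).trans (add_le_add hfN hgN)
  intro ω (hω : ε ≤ |f N ω * g N ω|)
  by_contra hcon
  simp only [Set.mem_union, Set.mem_ofPred_eq, not_or, not_le] at hcon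
  rw [abs_mul] at hω
  have := mul_lt_mul'' hcon.1 hcon.2 (abs_nonneg _) (abs_nonneg _)
  rw [div_mul_cancel₀ _ hC.ne'] at this
  linarith

lemma NegligibleInProb.bddInProb (hf : NegligibleInProb P f) : BddInProb P f := fun η hη =>
  ⟨1, one_pos, ENNReal.tendsto_nhds_zero.1 (hf 1 one_pos) η hη⟩

lemma bddInProb_one : BddInProb P fun _ _ => 1 := fun η _ =>
  ⟨2, two_pos, Eventually.of_forall fun N => by norm_num⟩

lemma BddInProb.div_natCast (hf : BddInProb P f) : NegligibleInProb P fun N ω => f N ω / N := by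
  have h : NegligibleInProb P fun N _ => 1 / (N : ℝ) := by
    intro ε hε
    refine tendsto_const_nhds.congr' ?_
    filter_upwards [(tendsto_one_div_atTop_nhds_zero_nat (𝕜 := ℝ)).eventually (gt_mem_nhds hε)]
      with N hN
    have h1 : {ω : Ω N | ε ≤ |1 / (N : ℝ)|} = ∅ := by
      rw [abs_of_nonneg (by positivity)]
      exact Set.eq_empty_of_forall_notMem fun ω hω => absurd hω (not_le.2 hN)
    rw [h1, measure_empty]
  exact (h.mul_bddInProb hf).of_le (Eventually.of_forall fun N ω =>
    (congrArg abs (by ring : f N ω / N = 1 / N * f N ω)).le)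

lemma NegligibleInProb.of_sq (hf : NegligibleInProb P fun N ω => f N ω ^ 2) :
    NegligibleInProb P f := by
  intro ε hε
  refine tendsto_of_tendsto_of_tendsto_of_le_of_le tendsto_const_nhds (hf (ε ^ 2) (by positivity))
    (fun _ => zero_le) fun N => measure_mono fun ω (hω : ε ≤ |f N ω|) => ?_
  change ε ^ 2 ≤ |f N ω ^ 2|
  rw [abs_pow]
  exact pow_le_pow_left₀ hε.le hω 2

lemma NegligibleInProb.inv_one_add_sub_one (hf : NegligibleInProb P f) :
    NegligibleInProb P fun N ω => (1 + f N ω)⁻¹ - 1 := by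
  intro ε hε
  have hδ : 0 < min (1 / 2) (ε / 2) := by positivity
  refine tendsto_of_tendsto_of_tendsto_of_le_of_le tendsto_const_nhds (hf _ hδ)
    (fun _ => zero_le) fun N => measure_mono fun ω (hω : ε ≤ |(1 + f N ω)⁻¹ - 1|) => ?_
  by_contra hcon
  simp only [Set.mem_ofPred_eq, not_le, lt_min_iff] at hcon
  have h1 : 1 / 2 < 1 + f N ω := by linarith [(abs_lt.1 hcon.1).1]
  have h2 : (1 + f N ω)⁻¹ - 1 = -f N ω / (1 + f N ω) := by
    have : 1 + f N ω ≠ 0 := by linarith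
    field_simp
    ring
  rw [h2, abs_div, abs_neg, abs_of_pos (show 0 < 1 + f N ω by linarith),
    le_div_iff₀ (by linarith)] at hω
  nlinarith [hcon.2]

lemma bddInProb_of_lintegral_sq_le (hf : ∀ N, Measurable (f N)) {C : ℝ} (hC : 0 ≤ C)
    (h : ∀ N, ∫⁻ ω, ENNReal.ofReal (f N ω ^ 2) ∂(P N) ≤ ENNReal.ofReal C) : BddInProb P f := by
  intro η hη
  obtain ⟨r, hr, hrη⟩ : ∃ r : ℝ, 0 < r ∧ ENNReal.ofReal r ≤ η := by
    obtain ⟨r, hr0, hr⟩ := ENNReal.lt_iff_exists_nnreal_btwn.1 hη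
    exact ⟨r, by simpa using hr0, by simpa using hr.le⟩
  have hK : 0 < √(C / r) + 1 := by positivity
  refine ⟨√(C / r) + 1, hK, Eventually.of_forall fun N => le_trans ?_ hrη⟩
  calc P N {ω | √(C / r) + 1 ≤ |f N ω|}
      ≤ P N {ω | ENNReal.ofReal ((√(C / r) + 1) ^ 2) ≤ ENNReal.ofReal (f N ω ^ 2)} := by
        refine measure_mono fun ω (hω : _ ≤ |f N ω|) => ?_
        refine ENNReal.ofReal_le_ofReal (?_ : _ ≤ f N ω ^ 2)
        rw [← sq_abs (f N ω)]
        exact pow_le_pow_left₀ hK.le hω 2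
    _ ≤ (∫⁻ ω, ENNReal.ofReal (f N ω ^ 2) ∂(P N)) / ENNReal.ofReal ((√(C / r) + 1) ^ 2) :=
        meas_ge_le_lintegral_div ((hf N).pow_const 2).ennreal_ofReal.aemeasurable
          (by simpa using by positivity) ENNReal.ofReal_ne_top
    _ ≤ ENNReal.ofReal C / ENNReal.ofReal ((√(C / r) + 1) ^ 2) := ENNReal.div_le_div_right (h N) _
    _ ≤ ENNReal.ofReal r := by
        rw [← ENNReal.ofReal_div_of_pos (by positivity)]
        refine ENNReal.ofReal_le_ofReal ?_
        rw [div_le_iff₀ (by positivity)]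
        have h1 : C = r * √(C / r) ^ 2 := by
          rw [Real.sq_sqrt (by positivity)]; field_simp
        nlinarith [Real.sqrt_nonneg (C / r)]

end InProbability

/-- Chebyshev's inequality for the squared norm of a standard Gaussian vector; `C` is the variance
of the square of a standard normal variable. -/
lemma exists_stdGaussian_norm_sq_deviation_le : ∃ C : ℝ, ∀ N : ℕ, N ≠ 0 → ∀ ε : ℝ, 0 < ε →
    stdGaussian (EuclideanSpace ℝ (Fin N)) {z | ε ≤ |‖z‖ ^ 2 / N - 1|} ≤
      ENNReal.ofReal (C / N / ε ^ 2) := by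
  set γ := gaussianReal 0 1 with hγ
  have hL2 : MemLp (fun x : ℝ => x ^ 2) 2 γ := by
    have h4 : MemLp (id : ℝ → ℝ) 4 γ := by
      simpa using memLp_id_gaussianReal (μ := 0) (v := 1) 4
    have := h4.norm_rpow_div 2
    have h42 : (4 : ℝ≥0∞) / 2 = 2 := by
      rw [show (4 : ℝ≥0∞) = 2 * 2 by norm_num, ENNReal.mul_div_cancel_right (by simp) (by simp)]
    rw [h42] at this
    refine this.congr_norm (by fun_prop) (ae_of_all _ fun x => ?_)
    simp
  have hmean : ∫ x, x ^ 2 ∂γ = 1 := by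
    have h1 := variance_id_gaussianReal (μ := 0) (v := 1)
    rw [variance_of_integral_eq_zero (by fun_prop) (by simp)] at h1
    simpa using h1
  refine ⟨Var[fun x : ℝ => x ^ 2; γ], fun N hN ε hε => ?_⟩
  have hN0 : (0 : ℝ) < N := by positivity
  set π := Measure.pi fun _ : Fin N => γ with hπ
  have hcoord : ∀ n : Fin N, MemLp (fun x : Fin N → ℝ => x n ^ 2) 2 π := fun n =>
    hL2.comp_measurePreserving (measurePreserving_eval (fun _ : Fin N => γ) n)
  have hsum : MemLp (∑ n : Fin N, fun x : Fin N → ℝ => x n ^ 2) 2 π :=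
    memLp_finsetSum' _ fun n _ => hcoord n
  have hvar : Var[∑ n : Fin N, fun x : Fin N → ℝ => x n ^ 2; π] =
      N * Var[fun x : ℝ => x ^ 2; γ] := by
    rw [hπ, variance_sum_pi (X := fun (_ : Fin N) (x : ℝ) => x ^ 2) fun _ => hL2]
    simp
  have hE : ∫ x, (∑ n : Fin N, fun x : Fin N → ℝ => x n ^ 2) x ∂π = N := by
    simp only [Finset.sum_apply]
    rw [integral_finsetSum _ fun n _ => (hcoord n).integrable (by norm_num)]
    have : ∀ n : Fin N, ∫ x, x n ^ 2 ∂π = 1 := fun n => by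
      rw [hπ, integral_comp_eval (μ := fun _ : Fin N => γ) (i := n) (f := fun x : ℝ => x ^ 2)
        (by fun_prop), hmean]
    simp [this]
  have hset : MeasurableSet {z : EuclideanSpace ℝ (Fin N) | ε ≤ |‖z‖ ^ 2 / N - 1|} :=
    measurableSet_le measurable_const (by fun_prop)
  rw [← map_pi_eq_stdGaussian, Measure.map_apply (by fun_prop) hset]
  have hsub : (WithLp.toLp 2 ⁻¹' {z : EuclideanSpace ℝ (Fin N) | ε ≤ |‖z‖ ^ 2 / N - 1|}) ⊆
      {x | N * ε ≤ |(∑ n : Fin N, fun x : Fin N → ℝ => x n ^ 2) x -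
        ∫ x, (∑ n : Fin N, fun x : Fin N → ℝ => x n ^ 2) x ∂π|} := by
    intro x (hx : ε ≤ |‖WithLp.toLp 2 x‖ ^ 2 / N - 1|)
    rw [EuclideanSpace.real_norm_sq_eq] at hx
    rw [Set.mem_ofPred_eq, hE, Finset.sum_apply]
    have : ∑ n, x n ^ 2 - N = N * ((∑ n, x n ^ 2) / N - 1) := by field_simp
    rw [this, abs_mul, abs_of_pos hN0]
    exact mul_le_mul_of_nonneg_left hx hN0.le
  refine (measure_mono hsub).trans ((meas_ge_le_variance_div_sq hsum (by positivity)).trans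
    (ENNReal.ofReal_le_ofReal (le_of_eq ?_)))
  rw [hvar]
  field_simp

/-! ### Asymptotics of the gains under the null hypothesis -/

section Asymptotics

variable {J M : ℕ} {A : Finset (Fin M)} {μ : Fin M → ℝ} {v : Fin M → ℝ≥0}
  {Ω : ℕ → Type*} [∀ N, MeasurableSpace (Ω N)] {P : ∀ N, Measure (Ω N)}
  [∀ N, IsProbabilityMeasure (P N)] {X : ∀ N, Ω N → Matrix (Fin N) (Fin M) ℝ}
  {y : ∀ N, Ω N → Fin N → Fin J} {i s : Fin M} {S : Finset (Fin M)}

lemma bddInProb_inner_stdVec (h : ∀ N, IsNull (P N) (X N) (y N) A μ v) (hv : ∀ i ∉ A, v i ≠ 0)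
    (hiA : i ∉ A) {e : ∀ N, Ω N → EuclideanSpace ℝ (Fin N)}
    (he : ∀ N, Measurable[otherAlgebra (X N) (y N) i] (e N)) (hnorm : ∀ N ω, ‖e N ω‖ ≤ 1) :
    BddInProb P fun N ω => ⟪e N ω, stdVec (X N ω) μ v i⟫_ℝ := by
  refine bddInProb_of_lintegral_sq_le (fun N => ?_) zero_le_one fun N => ?_
  · exact ((he N).mono ((h N).otherAlgebra_le i) le_rfl).inner ((h N).measurable_stdVec i)
  · rw [ENNReal.ofReal_one]
    exact (h N).lintegral_inner_stdVec_sq_le_one hiA (hv i hiA) (he N) (hnorm N)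

lemma measurable_otherAlgebra_residual {N : ℕ} {Ω' : Type*} {X : Ω' → Matrix (Fin N) (Fin M) ℝ}
    {y : Ω' → Fin N → Fin J} (hiS : i ∉ S) {f : Ω' → EuclideanSpace ℝ (Fin N)}
    (hf : Measurable[otherAlgebra X y i] f) :
    Measurable[otherAlgebra X y i] fun ω => residual (colSpan (X ω) S) (f ω) :=
  @measurable_residual_colSpan N M Ω' (otherAlgebra X y i) X S
    (fun _ hk => measurable_colVec_of_apply fun n =>
      measurable_otherAlgebra_apply (ne_of_mem_of_not_mem hk hiS) n) f hf

/-- The direction that the variable `s` adds to the span of `S` is independent of the candidate `i`,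
so that their inner product is bounded in probability. -/
lemma bddInProb_inner_unitVec (h : ∀ N, IsNull (P N) (X N) (y N) A μ v)
    (hv : ∀ i ∉ A, v i ≠ 0) (hiA : i ∉ A) (hiS : i ∉ S) (his : i ≠ s) :
    BddInProb P fun N ω => ⟪unitVec (residual (colSpan (X N ω) S) (colVec (X N ω) s)),
      stdVec (X N ω) μ v i⟫_ℝ :=
  bddInProb_inner_stdVec h hv hiA (fun N => @measurable_unitVec _ (otherAlgebra (X N) (y N) i) _
    _ _ _ _ _ _ (measurable_otherAlgebra_residual hiS (measurable_colVec_of_apply fun n =>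
      measurable_otherAlgebra_apply his.symm n))) fun _ _ => norm_unitVec_le _

/-- The class components of the residual of a candidate are bounded in probability. -/
lemma bddInProb_norm_classCoord (h : ∀ N, IsNull (P N) (X N) (y N) A μ v)
    (hv : ∀ i ∉ A, v i ≠ 0) (hiA : i ∉ A) (hiS : i ∉ S) :
    BddInProb P fun N ω =>
      ‖classCoord (y N ω) (residual (colSpan (X N ω) S) (stdVec (X N ω) μ v i))‖ := by
  refine bddInProb_of_lintegral_sq_le (C := J) (fun N => ?_) (Nat.cast_nonneg J) fun N => ?_
  · exact measurable_norm_classCoord (h N).measurable_labels (measurable_residual_colSpan S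
      (fun k _ => measurable_colVec_of_apply fun n => (h N).measurable_X n k)
      ((h N).measurable_stdVec i))
  · have he : ∀ j, Measurable[otherAlgebra (X N) (y N) i] fun ω =>
        residual (colSpan (X N ω) S) (classVec (y N ω) j) := fun j =>
      measurable_otherAlgebra_residual hiS
        (@measurable_classVec _ _ _ (otherAlgebra (X N) (y N) i) _ (measurable_otherAlgebra_y i) j)
    simp only [norm_sq_classCoord, inner_classVec_residual,
      ENNReal.ofReal_sum_of_nonneg fun _ _ => sq_nonneg _]
    rw [lintegral_finsetSum]
    · refine (Finset.sum_le_sum fun j _ => (h N).lintegral_inner_stdVec_sq_le_one hiA (hv i hiA)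
        (he j) fun ω => (norm_residual_le _ _).trans (norm_classVec_le _ _)).trans ?_
      simp
    · intro j _
      exact ((((he j).mono ((h N).otherAlgebra_le i) le_rfl).inner
        ((h N).measurable_stdVec i)).pow_const 2).ennreal_ofReal

omit [∀ N, IsProbabilityMeasure (P N)] in
lemma negligibleInProb_norm_sq_stdVec (h : ∀ N, IsNull (P N) (X N) (y N) A μ v)
    (hv : ∀ i ∉ A, v i ≠ 0) (hiA : i ∉ A) :
    NegligibleInProb P fun N ω => ‖stdVec (X N ω) μ v i‖ ^ 2 / N - 1 := by
  intro ε hε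
  obtain ⟨C, hC⟩ := exists_stdGaussian_norm_sq_deviation_le
  have hlim : Tendsto (fun N : ℕ => ENNReal.ofReal (C / N / ε ^ 2)) atTop (𝓝 0) := by
    have := (tendsto_const_div_atTop_nhds_zero_nat C).div_const (ε ^ 2)
    rw [zero_div] at this
    simpa using ENNReal.tendsto_ofReal this
  refine tendsto_of_tendsto_of_tendsto_of_le_of_le' tendsto_const_nhds hlim
    (Eventually.of_forall fun _ => zero_le) ?_
  filter_upwards [eventually_ne_atTop 0] with N hN
  have hset : MeasurableSet {z : EuclideanSpace ℝ (Fin N) | ε ≤ |‖z‖ ^ 2 / N - 1|} :=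
    measurableSet_le measurable_const (by fun_prop)
  have := hC N hN ε hε
  rwa [← (h N).map_stdVec hiA (hv i hiA),
    Measure.map_apply ((h N).measurable_stdVec i) hset] at this

/-- Projecting a candidate on the orthogonal complement of finitely many directions does not change
its squared norm to first order. -/
lemma negligibleInProb_norm_sq_residual (h : ∀ N, IsNull (P N) (X N) (y N) A μ v)
    (hv : ∀ i ∉ A, v i ≠ 0) (hiA : i ∉ A) (hiS : i ∉ S) :
    NegligibleInProb P fun N ω =>
      ‖residual (colSpan (X N ω) S) (stdVec (X N ω) μ v i)‖ ^ 2 / N - 1 := by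
  have step : ∀ {f : ∀ N, Ω N → ℝ} {b : ∀ N, Ω N → ℝ}, BddInProb P b →
      NegligibleInProb P (fun N ω => f N ω / N - 1) →
      NegligibleInProb P fun N ω => (f N ω - b N ω ^ 2) / N - 1 := by
    intro f b hb hf
    have h1 : NegligibleInProb P fun N ω => (-1 : ℝ) * (b N ω * b N ω / N) := by
      have h2 := (hb.mul hb).div_natCast
      exact h2.of_le (Eventually.of_forall fun N ω => by rw [abs_mul, abs_neg, abs_one, one_mul])
    exact (hf.add h1).of_le (Eventually.of_forall fun N ω => (congrArg abs (by ring)).le)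
  induction S using Finset.induction_on with
  | empty =>
    have h1 := bddInProb_inner_stdVec h hv hiA
      (e := fun N _ => unitVec (residual ⊥ (onesVec N))) (fun N => measurable_const)
      fun _ _ => norm_unitVec_le _
    have h0 : ∀ N (v : EuclideanSpace ℝ (Fin N)), residual ⊥ v = v := fun N v => by simp [residual]
    have h2 := step h1 (negligibleInProb_norm_sq_stdVec h hv hiA)
    simp only [colSpan_empty, norm_sq_residual_sup_span]
    simp only [h0] at h2 ⊢
    exact h2
  | insert s S _ ih =>
    rw [Finset.mem_insert, not_or] at hiS
    simp only [colSpan_insert, norm_sq_residual_sup_span]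
    exact step (bddInProb_inner_unitVec h hv hiA hiS.2 hiS.1) (ih hiS.2)

lemma gain_mul_natCast {N : ℕ} (y : Fin N → Fin J) (X : Matrix (Fin N) (Fin M) ℝ)
    (S : Finset (Fin M)) (x : EuclideanSpace ℝ (Fin N)) :
    N * gain y X S x = ‖classCoord y (residual (colSpan X S) x)‖ ^ 2 *
      (1 + (‖residual (colSpan X S) x‖ ^ 2 / N - 1))⁻¹ := by
  rw [gain_eq_div, add_sub_cancel, inv_div]
  ring

/-- The gain of a candidate tends to zero in probability, since `N` times it is bounded. -/
lemma negligibleInProb_gain (h : ∀ N, IsNull (P N) (X N) (y N) A μ v)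
    (hv : ∀ i ∉ A, v i ≠ 0) (hiA : i ∉ A) (hiS : i ∉ S) :
    NegligibleInProb P fun N ω => gain (y N ω) (X N ω) S (stdVec (X N ω) μ v i) := by
  have h1 := bddInProb_norm_classCoord h hv hiA hiS
  have h2 := (negligibleInProb_norm_sq_residual h hv hiA hiS).inv_one_add_sub_one.bddInProb.add
    bddInProb_one
  refine ((h1.mul h1).mul h2).div_natCast.of_le ?_
  filter_upwards [eventually_ne_atTop 0] with N hN ω
  refine (congrArg abs ?_).le
  rw [sub_add_cancel, ← sq, ← gain_mul_natCast, mul_div_cancel_left₀ _ (by positivity)]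

/-- The class components of the residual of a candidate do not depend, to first order, on the
candidates that have been selected before it: each of those contributes a direction whose own class
components vanish in the limit. -/
lemma negligibleInProb_norm_classCoord_sub (h : ∀ N, IsNull (P N) (X N) (y N) A μ v)
    (hv : ∀ i ∉ A, v i ≠ 0) (hiA : i ∉ A) (hAS : A ⊆ S) (hiS : i ∉ S) :
    NegligibleInProb P fun N ω =>
      ‖classCoord (y N ω) (residual (colSpan (X N ω) S) (stdVec (X N ω) μ v i))‖ -
        ‖classCoord (y N ω) (residual (colSpan (X N ω) A) (stdVec (X N ω) μ v i))‖ := by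
  have key : ∀ B : Finset (Fin M), i ∉ B → NegligibleInProb P fun N ω =>
      ‖classCoord (y N ω) (residual (colSpan (X N ω) (A ∪ B)) (stdVec (X N ω) μ v i))‖ -
        ‖classCoord (y N ω) (residual (colSpan (X N ω) A) (stdVec (X N ω) μ v i))‖ := by
    intro B hiB
    induction B using Finset.induction_on with
    | empty =>
      simp only [Finset.union_empty, sub_self]
      exact fun ε hε => by simp [not_le.2 hε]
    | insert s B _ ih =>
      rw [Finset.mem_insert, not_or] at hiB
      rw [Finset.union_insert]
      by_cases hs : s ∈ A ∪ B
      · rw [Finset.insert_eq_of_mem hs]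
        exact ih hiB.2
      have hsA : s ∉ A := fun hsA => hs (Finset.mem_union_left B hsA)
      have hiAB : i ∉ A ∪ B := by simp [hiA, hiB.2]
      have h1 : NegligibleInProb P fun N ω => ‖classCoord (y N ω)
          (unitVec (residual (colSpan (X N ω) (A ∪ B)) (colVec (X N ω) s)))‖ := by
        refine NegligibleInProb.of_sq ((negligibleInProb_gain h hv hsA hs).of_le
          (Eventually.of_forall fun N ω => (congrArg abs ?_).le))
        rw [← gain, colVec_eq_smul_add (X N ω) (hv s hsA), gain_smul_add]
        have := hv s hsA
        positivity
      have h2 := h1.mul_bddInProb (bddInProb_inner_unitVec h hv hiA hiAB hiB.1)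
      have h3 : NegligibleInProb P fun N ω => ‖classCoord (y N ω)
          (residual (colSpan (X N ω) (insert s (A ∪ B))) (stdVec (X N ω) μ v i))‖ -
            ‖classCoord (y N ω) (residual (colSpan (X N ω) (A ∪ B)) (stdVec (X N ω) μ v i))‖ := by
        refine h2.of_le (Eventually.of_forall fun N ω => ?_)
        rw [colSpan_insert, residual_sup_span, map_sub, map_smul]
        refine (abs_norm_sub_norm_le _ _).trans (le_of_eq ?_)
        rw [sub_sub_cancel_left, norm_neg, norm_smul, Real.norm_eq_abs, abs_mul, abs_norm, mul_comm]
      exact (h3.add (ih hiB.2)).of_le (Eventually.of_forall fun N ω =>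
        (congrArg abs (sub_add_sub_cancel _ _ _).symm).le)
  have := key S hiS
  rwa [Finset.union_eq_right.2 hAS] at this

/-- `N` times the gain of a candidate is, to first order, the same whichever candidates have been
selected before it. -/
lemma negligibleInProb_gain_sub (h : ∀ N, IsNull (P N) (X N) (y N) A μ v)
    (hv : ∀ i ∉ A, v i ≠ 0) (hiA : i ∉ A) (hAS : A ⊆ S) (hiS : i ∉ S) :
    NegligibleInProb P fun N ω => N * gain (y N ω) (X N ω) S (stdVec (X N ω) μ v i) -
      ‖classCoord (y N ω) (residual (colSpan (X N ω) A) (stdVec (X N ω) μ v i))‖ ^ 2 := by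
  have h1 := (negligibleInProb_norm_sq_residual h hv hiA hiS).inv_one_add_sub_one
  have hbS := bddInProb_norm_classCoord h hv hiA hiS
  have hbA := bddInProb_norm_classCoord h hv hiA hiA
  have h2 := h1.mul_bddInProb (hbS.mul hbS)
  have h3 := (negligibleInProb_norm_classCoord_sub h hv hiA hAS hiS).mul_bddInProb (hbS.add hbA)
  refine (h2.add h3).of_le (Eventually.of_forall fun N ω => (congrArg abs ?_).le)
  rw [gain_mul_natCast]
  ring

/-- Outside an event of vanishing probability, no candidate lies in the span of the constant vector
and a set of other variables that contains `A`, and all gains of a candidate agree up to an error of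
order `ε / N`. -/
lemma exists_tendsto_measure_exceptional (h : ∀ N, IsNull (P N) (X N) (y N) A μ v)
    (hv : ∀ i ∉ A, v i ≠ 0) {ε : ℝ} (hε : 0 < ε) :
    ∃ B : ∀ N, Set (Ω N), Tendsto (fun N => P N (B N)) atTop (𝓝 0) ∧
      ∀ N, ∀ ω ∉ B N, ∀ S, A ⊆ S → ∀ i ∉ S,
        residual (colSpan (X N ω) S) (colVec (X N ω) i) ≠ 0 ∧
        |N * gain (y N ω) (X N ω) S (colVec (X N ω) i) -
          ‖classCoord (y N ω) (residual (colSpan (X N ω) A) (stdVec (X N ω) μ v i))‖ ^ 2| < ε := by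
  let I : Finset (Finset (Fin M) × Fin M) :=
    Finset.univ.filter fun q => A ⊆ q.1 ∧ q.2 ∉ q.1
  let u : Finset (Fin M) × Fin M → ∀ N, Ω N → ℝ := fun q N ω =>
    ‖residual (colSpan (X N ω) q.1) (stdVec (X N ω) μ v q.2)‖ ^ 2 / N - 1
  let d : Finset (Fin M) × Fin M → ∀ N, Ω N → ℝ := fun q N ω =>
    N * gain (y N ω) (X N ω) q.1 (stdVec (X N ω) μ v q.2) -
      ‖classCoord (y N ω) (residual (colSpan (X N ω) A) (stdVec (X N ω) μ v q.2))‖ ^ 2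
  refine ⟨fun N => ⋃ q ∈ I, ({ω | 1 / 2 ≤ |u q N ω|} ∪ {ω | ε ≤ |d q N ω|}), ?_, ?_⟩
  · have hlim : Tendsto (fun N => ∑ q ∈ I,
        (P N {ω | 1 / 2 ≤ |u q N ω|} + P N {ω | ε ≤ |d q N ω|})) atTop (𝓝 0) := by
      have : (0 : ℝ≥0∞) = ∑ q ∈ I, (0 + 0) := by simp
      rw [this]
      refine tendsto_finsetSum _ fun q hq => ?_
      obtain ⟨hAq, hq⟩ := (Finset.mem_filter.1 hq).2
      have hqA : q.2 ∉ A := fun hqA => hq (hAq hqA)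
      exact (negligibleInProb_norm_sq_residual h hv hqA hq (1 / 2) (by norm_num)).add
        (negligibleInProb_gain_sub h hv hqA hAq hq ε hε)
    exact tendsto_of_tendsto_of_tendsto_of_le_of_le tendsto_const_nhds hlim (fun _ => zero_le)
      fun N => (measure_biUnion_finset_le I _).trans
        (Finset.sum_le_sum fun q _ => measure_union_le _ _)
  · intro N ω hω S hAS i hi
    have hiA : i ∉ A := fun hiA => hi (hAS hiA)
    have hω' : ω ∉ {ω | 1 / 2 ≤ |u (S, i) N ω|} ∪ {ω | ε ≤ |d (S, i) N ω|} := fun hmem =>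
      hω (Set.mem_biUnion (x := (S, i))
        (Finset.mem_coe.2 (Finset.mem_filter.2 ⟨Finset.mem_univ _, hAS, hi⟩)) hmem)
    simp only [Set.mem_union, Set.mem_ofPred_eq, not_or, not_le] at hω'
    have hs : √(v i : ℝ) ≠ 0 := by
      have := hv i hiA
      positivity
    rw [colVec_eq_smul_add (X N ω) (hv i hiA), gain_smul_add _ _ _ _ _ hs]
    refine ⟨?_, hω'.2⟩
    rw [residual_add, residual_smul, residual_smul,
      (residual_eq_zero_iff _ _).2 (onesVec_mem_colSpan _ _), smul_zero, zero_add]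
    refine smul_ne_zero hs fun h0 => ?_
    have h1 := hω'.1
    simp only [u, h0, norm_zero] at h1
    norm_num at h1

end Asymptotics

end PillaiForward

/-! ### The level of the sequential test -/

theorem theorem2
    (J M K : ℕ) (hJ : 2 ≤ J) (α : ℝ) (hα0 : 0 < α) (hα1 : α < 1)
    -- the variables selected first; all the others are candidates under the null
    (A : Finset (Fin M)) (hAK : A.card < K) (hKM : K ≤ M)
    (μ : Fin M → ℝ) (v : Fin M → ℝ≥0) (hv : ∀ i ∉ A, v i ≠ 0)
    -- for every sample size `N`, a random data matrix and random class labels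
    {Ω : ℕ → Type*} [∀ N, MeasurableSpace (Ω N)]
    (P : ∀ N, Measure (Ω N)) [∀ N, IsProbabilityMeasure (P N)]
    (X : ∀ N, Ω N → Matrix (Fin N) (Fin M) ℝ) (y : ∀ N, Ω N → Fin N → Fin J)
    (hnull : ∀ N, PillaiForward.IsNull (P N) (X N) (y N) A μ v)
    -- the total scatter matrix of the variables selected first is invertible
    (hT : ∀ᶠ N in atTop, ∀ᵐ ω ∂(P N),
      IsUnit (PillaiForward.totalScatter (PillaiForward.columns (X N ω) A)).det)
    -- the sets of selected variables
    (S : ∀ N, Ω N → ℕ → Finset (Fin M))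
    (hS : ∀ N ω, PillaiForward.IsForwardSelection (y N ω) (X N ω) A K (S N ω)) :
    limsup (fun N => P N {ω | PillaiForward.threshold α J M K N ≤
      PillaiForward.pillaiOf (y N ω) (X N ω) (S N ω K) -
        PillaiForward.pillaiOf (y N ω) (X N ω) (S N ω (K - 1))}) atTop
      ≤ ENNReal.ofReal α := by
  open PillaiForward in
  -- any fixed set of `M - K + 1` candidates will do
  obtain ⟨T, hTA, hTcard⟩ : ∃ T ⊆ Aᶜ, T.card = M - K + 1 := by
    refine Finset.exists_subset_card_eq ?_
    rw [Finset.card_compl, Fintype.card_fin]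
    omega
  have hdisj : Disjoint T A := Finset.disjoint_left.2 fun i hi => Finset.mem_compl.1 (hTA hi)
  have hcast : ((M - K + 1 : ℕ) : ℝ) = (M : ℝ) - K + 1 := by
    rw [Nat.cast_add, Nat.cast_sub hKM, Nat.cast_one]
  set p : ℝ := (1 - α) ^ (1 / ((M : ℝ) - (K : ℝ) + 1)) with hp
  have hα : 0 < 1 - α := sub_pos.2 hα1
  have hp0 : 0 < p := Real.rpow_pos_of_pos hα _
  have hp1 : p < 1 := Real.rpow_lt_one hα.le (by linarith) (by rw [← hcast]; positivity)
  have hpm : p ^ T.card = 1 - α := by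
    rw [hTcard, hp, ← Real.rpow_natCast, ← Real.rpow_mul hα.le, hcast, one_div_mul_cancel,
      Real.rpow_one]
    rw [← hcast]
    positivity
  refine ENNReal.le_of_forall_pos_le_add fun η hη _ => ?_
  have hη2 : 0 < (η : ℝ) / 2 := half_pos (NNReal.coe_pos.2 hη)
  -- a margin `δ` on `p` costs at most `η / 2` on the level
  obtain ⟨δ, hδ, hpδ, hδm⟩ : ∃ δ, 0 < δ ∧ 0 < p - δ ∧ 1 - α - η / 2 < (p - δ) ^ T.card := by
    have hcont : Tendsto (fun δ : ℝ => (p - δ) ^ T.card) (𝓝[>] 0) (𝓝 (p ^ T.card)) := by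
      have : Continuous fun δ : ℝ => (p - δ) ^ T.card := by fun_prop
      simpa using (this.tendsto 0).mono_left nhdsWithin_le_nhds
    have h1 := hcont.eventually (lt_mem_nhds (show 1 - α - η / 2 < p ^ T.card by
      rw [hpm]; linarith))
    have h2 : ∀ᶠ δ : ℝ in 𝓝[>] 0, δ < p := nhdsWithin_le_nhds (gt_mem_nhds hp0)
    obtain ⟨δ, h1, h2, h3⟩ := (h1.and (h2.and self_mem_nhdsWithin)).exists
    exact ⟨δ, h3, sub_pos.2 h2, h1⟩
  obtain ⟨c, ε, hε, hc, hthr⟩ := exists_eventually_lt_quantile hJ hp0 hp1 hδ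
  obtain ⟨B, hB, hBgood⟩ := exists_tendsto_measure_exceptional hnull hv
    (show 0 < ε / 3 by positivity)
  have hBη := ENNReal.tendsto_nhds_zero.1 hB (ENNReal.ofReal (η / 2)) (by simpa using hη)
  refine limsup_le_of_le (by isBoundedDefault) ?_
  filter_upwards [hthr, hBη, hT, eventually_ne_atTop 0] with N hthrN hBN hTN hN
  set G : Set (Ω N) := {ω | ∀ i ∈ T, ‖classCoord (y N ω) (residual (colSpan (X N ω) A)
    (stdVec (X N ω) μ v i))‖ ^ 2 < c} with hG
  have hGm : MeasurableSet G := measurableSet_forall_norm_sq_classCoord_lt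
    (hnull N).measurable_labels
    (fun k _ => measurable_colVec_of_apply fun n => (hnull N).measurable_X n k)
    (fun k _ => (hnull N).measurable_stdVec k) c
  have hGc : P N Gᶜ ≤ ENNReal.ofReal (α + η / 2) := by
    rw [prob_compl_eq_one_sub hGm, tsub_le_iff_right]
    have h1 := (hnull N).chiSqCdf_pow_le hv hN c T hdisj
    have h2 : ENNReal.ofReal (1 - α - η / 2) ≤ P N G := by
      refine le_trans ?_ h1
      rw [← ENNReal.ofReal_pow (hpδ.trans hc).le]
      exact ENNReal.ofReal_le_ofReal (hδm.le.trans (pow_le_pow_left₀ hpδ.le hc.le _))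
    calc (1 : ℝ≥0∞) = ENNReal.ofReal ((α + η / 2) + (1 - α - η / 2)) := by
          rw [← ENNReal.ofReal_one]; congr 1; ring
      _ ≤ ENNReal.ofReal (α + η / 2) + ENNReal.ofReal (1 - α - η / 2) := ENNReal.ofReal_add_le
      _ ≤ _ := by gcongr
  have hsub : ∀ᵐ ω ∂(P N), ω ∈ {ω | threshold α J M K N ≤ pillaiOf (y N ω) (X N ω) (S N ω K) -
      pillaiOf (y N ω) (X N ω) (S N ω (K - 1))} → ω ∈ B N ∪ Gᶜ := by
    filter_upwards [hTN] with ω hunit hω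
    by_contra hcon
    -- outside `B N` the gains are nearly constant, so a large gain at step `K` contradicts `G`
    rw [Set.mem_union, not_or, Set.notMem_compl_iff] at hcon
    obtain ⟨hωB, hωG⟩ := hcon
    have hgood := hBgood N ω hωB
    obtain ⟨i, hiT, hi⟩ := (hS N ω).exists_mem_lt hAK hKM hunit
      (fun S hAS i hiS => (hgood S hAS i hiS).1)
      (τ := fun i => ‖classCoord (y N ω) (residual (colSpan (X N ω) A)
        (stdVec (X N ω) μ v i))‖ ^ 2)
      (fun S hAS i hiS => (hgood S hAS i hiS).2) hω hdisj hTcard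
    have h1 := hωG i hiT
    have h2 : c + ε ≤ N * threshold α J M K N := hthrN
    linarith
  calc P N _ ≤ P N (B N ∪ Gᶜ) := measure_mono_ae hsub
    _ ≤ P N (B N) + P N Gᶜ := measure_union_le _ _
    _ ≤ ENNReal.ofReal (η / 2) + ENNReal.ofReal (α + η / 2) := add_le_add hBN hGc
    _ = ENNReal.ofReal α + η := by
      rw [← ENNReal.ofReal_add hη2.le (by linarith), ← ENNReal.ofReal_coe_nnreal,
        ← ENNReal.ofReal_add hα0.le (by linarith)]
      congr 1
      ring
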